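/- Let $\mathcal G$ be a finite metric graph with finite set of internal edges $\mathcal I$, finite set of external edges $\mathcal E$ and finite vertex set $V$ (each internal edge having an initial and a terminal vertex in $V$, each external edge an initial vertex); the internal edge $i\in\mathcal I$ is identified with $I_i=[0,a_i]$, $a_i>0$, and the external edge $e\in\mathcal E$ with $I_e=[0,\infty)$. Let $\mathcal H=\bigoplus_{j\in\mathcal E\cup\mathcal I}L^2(I_j)$ (complex-valued functions). Let $\Delta$ be the operator in $\mathcal H$ given by $(\Delta\psi)_j=\psi_j''$ on the domain $\mathcal D$ of all $\psi\in\mathcal H$ such that, for every edge $j$, $\psi_j$ and $\psi_j'$ are absolutely continuous (on compact subintervals of $I_j$) and $\psi_j''\in L^2(I_j)$. Let $\Delta^0$ be the restriction of $\Delta$ to those $\psi\in\mathcal D$ with $\psi_j(0)=\psi_j'(0)=0$ for all $j\in\mathcal E\cup\mathcal I$ and $\psi_i(a_i)=\psi_i'(a_i)=0$ for all $i\in\mathcal I$. Let $\mathcal K=\mathbb C^{\mathcal E}\oplus\mathbb C^{\mathcal I}\oplus\mathbb C^{\mathcal I}$, and for $\psi\in\mathcal D$ put $$\underline\psi=\bigl(\{\psi_e(0)\}_{e},\{\psi_i(0)\}_{i},\{\psi_i(a_i)\}_{i}\bigr)\in\mathcal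 K,\qquad \underline{\psi'}=\bigl(\{\psi_e'(0)\}_{e},\{\psi_i'(0)\}_{i},\{-\psi_i'(a_i)\}_{i}\bigr)\in\mathcal K .$$ For linear maps $A,B:\mathcal K\to\mathcal K$ let $-\Delta(A,B)$ be the restriction of $-\Delta$ to $\{\psi\in\mathcal D: A\underline\psi+B\underline{\psi'}=0\}$, and let $(A,B):\mathcal K^2\to\mathcal K$, $(\chi_1,\chi_2)\mapsto A\chi_1+B\chi_2$. A linear operator $T$ in $\mathcal H$ is called quasi-accretive if there is a $C\in\mathbb R$ with $\operatorname{Re}\langle u,Tu\rangle+C\langle u,u\rangle\ge 0$ for all $u\in\operatorname{Dom}(T)$, and quasi-m-accretive if it is quasi-accretive and closed and has no proper quasi-accretive extension in $\mathcal H$. Then for every quasi-m-accretive operator $T$ in $\mathcal H$ with $-\Delta^0\subset T\subset-\Delta$ there are linear maps $A,B:\mathcal K\to\mathcal K$ such that $(A,B):\mathcal K^2\to\mathcal K$ is surjective, that is, of rank $d=|\mathcal E|+2|\mathcal I|$, and $T=-\Delta(A,B)$. -/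

import Mathlib

open MeasureTheory Set
open scoped ENNReal

noncomputable section

/-! ### Accretive operators in a Hilbert space -/

section Accretive

variable {H : Type*} [NormedAddCommGroup H] [InnerProductSpace ℂ H]

/-- `Re ⟨u, T u⟩ + C ⟨u, u⟩ ≥ 0` on the domain of `T`, for some real constant `C`. -/
def IsQuasiAccretive (T : H →ₗ.[ℂ] H) : Prop :=
  ∃ C : ℝ, ∀ u : T.domain,
    0 ≤ (inner ℂ (u : H) (T u)).re + C * (inner ℂ (u : H) (u : H)).re

/-- A quasi-m-accretive operator: a closed quasi-accretive operator which has no proper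
quasi-accretive extension. -/
structure IsQuasiMAccretive (T : H →ₗ.[ℂ] H) : Prop where
  quasiAccretive : IsQuasiAccretive T
  isClosed : T.IsClosed
  maximal : ∀ T' : H →ₗ.[ℂ] H, T ≤ T' → IsQuasiAccretive T' → T' = T

end Accretive

/-! ### The space of functions `ψ` with `ψ, ψ'` absolutely continuous and `ψ''` in `L²` -/

section Interval

/-- `f` and its derivative `f₁` are absolutely continuous on `s` (that is, on each compact interval
with end points in `s`), and the almost everywhere defined second derivative `f₂` is square
integrable on `s`. Derivatives at the end points of `s` are one-sided. -/
structure IsTwiceAC (s : Set ℝ) (f f₁ f₂ : ℝ → ℂ) : Prop where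
  ac : ∀ a ∈ s, ∀ b ∈ s, AbsolutelyContinuousOnInterval f a b
  hasDeriv : ∀ x ∈ s, HasDerivWithinAt f (f₁ x) s x
  ac_deriv : ∀ a ∈ s, ∀ b ∈ s, AbsolutelyContinuousOnInterval f₁ a b
  hasDeriv_deriv : ∀ᵐ x ∂(volume.restrict s), HasDerivWithinAt f₁ (f₂ x) s x
  memLp : MemLp f₂ 2 (volume.restrict s)

theorem IsTwiceAC.add {s : Set ℝ} {f f₁ f₂ g g₁ g₂ : ℝ → ℂ} (hf : IsTwiceAC s f f₁ f₂)
    (hg : IsTwiceAC s g g₁ g₂) : IsTwiceAC s (f + g) (f₁ + g₁) (f₂ + g₂) where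
  ac a ha b hb := (hf.ac a ha b hb).add (hg.ac a ha b hb)
  hasDeriv x hx := (hf.hasDeriv x hx).add (hg.hasDeriv x hx)
  ac_deriv a ha b hb := (hf.ac_deriv a ha b hb).add (hg.ac_deriv a ha b hb)
  hasDeriv_deriv := by
    filter_upwards [hf.hasDeriv_deriv, hg.hasDeriv_deriv] with x h1 h2 using h1.add h2
  memLp := hf.memLp.add hg.memLp

theorem IsTwiceAC.smul {s : Set ℝ} {f f₁ f₂ : ℝ → ℂ} (c : ℂ) (hf : IsTwiceAC s f f₁ f₂) :
    IsTwiceAC s (c • f) (c • f₁) (c • f₂) where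
  ac a ha b hb := (hf.ac a ha b hb).const_smul c
  hasDeriv x hx := (hf.hasDeriv x hx).const_smul c
  ac_deriv a ha b hb := (hf.ac_deriv a ha b hb).const_smul c
  hasDeriv_deriv := by
    filter_upwards [hf.hasDeriv_deriv] with x h1 using h1.const_smul c
  memLp := hf.memLp.const_smul c

theorem IsTwiceAC.zero (s : Set ℝ) : IsTwiceAC s 0 0 0 where
  ac a _ b _ := by
    simpa using (LipschitzOnWith.of_dist_le_mul (K := 0) (f := (0 : ℝ → ℂ)) (s := uIcc a b)
      (by simp)).absolutelyContinuousOnInterval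
  hasDeriv x _ := hasDerivWithinAt_const x s (0 : ℂ)
  ac_deriv a _ b _ := by
    simpa using (LipschitzOnWith.of_dist_le_mul (K := 0) (f := (0 : ℝ → ℂ)) (s := uIcc a b)
      (by simp)).absolutelyContinuousOnInterval
  hasDeriv_deriv := Filter.Eventually.of_forall fun x => hasDerivWithinAt_const x s (0 : ℂ)
  memLp := MemLp.zero

/-- An interval (of any kind) with more than one point. -/
structure IsNontrivialInterval (s : Set ℝ) : Prop where
  convex : Convex ℝ s
  interior_nonempty : (interior s).Nonempty

theorem isNontrivialInterval_Icc {a : ℝ} (ha : 0 < a) : IsNontrivialInterval (Icc 0 a) :=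
  ⟨convex_Icc 0 a, by rw [interior_Icc]; exact nonempty_Ioo.2 ha⟩

theorem isNontrivialInterval_Ici : IsNontrivialInterval (Ici (0 : ℝ)) :=
  ⟨convex_Ici 0, by rw [interior_Ici]; exact nonempty_Ioi⟩

/-- Two representatives of the same `L²`-class have the same values and derivatives. -/
theorem IsTwiceAC.unique {s : Set ℝ} (hs : IsNontrivialInterval s) {f f₁ f₂ g g₁ g₂ : ℝ → ℂ}
    (hf : IsTwiceAC s f f₁ f₂) (hg : IsTwiceAC s g g₁ g₂) (hfg : f =ᵐ[volume.restrict s] g) :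
    EqOn f g s ∧ EqOn f₁ g₁ s ∧ f₂ =ᵐ[volume.restrict s] g₂ := by
  have hud : UniqueDiffOn ℝ s := uniqueDiffOn_convex hs.convex hs.interior_nonempty
  have h0 : EqOn f g s := by
    refine Measure.eqOn_of_ae_eq hfg (fun x hx => (hf.hasDeriv x hx).continuousWithinAt)
      (fun x hx => (hg.hasDeriv x hx).continuousWithinAt) ?_
    rw [hs.convex.closure_interior_eq_closure_of_nonempty_interior hs.interior_nonempty]
    exact subset_closure
  have h1 : EqOn f₁ g₁ s := fun x hx =>
    (hud x hx).eq_deriv s (hf.hasDeriv x hx) ((hg.hasDeriv x hx).congr h0 (h0 hx))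
  refine ⟨h0, h1, ?_⟩
  have hmem : ∀ᵐ x ∂(volume.restrict s), x ∈ s :=
    ae_restrict_mem hs.convex.ordConnected.measurableSet
  filter_upwards [hf.hasDeriv_deriv, hg.hasDeriv_deriv, hmem] with x h2 h3 hx
  exact (hud x hx).eq_deriv s h2 (h3.congr h1 (h1 hx))

/-- The set of all `u ∈ L²(s)` such that `u` and `u'` are absolutely continuous and `u''` is square
integrable. -/
def edgeDomain (s : Set ℝ) : Submodule ℂ (Lp ℂ 2 (volume.restrict s)) where
  carrier := {u | ∃ f f₁ f₂ : ℝ → ℂ, IsTwiceAC s f f₁ f₂ ∧ u =ᵐ[volume.restrict s] f}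
  zero_mem' := ⟨0, 0, 0, IsTwiceAC.zero s, Lp.coeFn_zero _ _ _⟩
  add_mem' := by
    rintro u v ⟨f, f₁, f₂, hf, hu⟩ ⟨g, g₁, g₂, hg, hv⟩
    exact ⟨f + g, f₁ + g₁, f₂ + g₂, hf.add hg, (Lp.coeFn_add u v).trans (hu.add hv)⟩
  smul_mem' := by
    rintro c u ⟨f, f₁, f₂, hf, hu⟩
    exact ⟨c • f, c • f₁, c • f₂, hf.smul c, (Lp.coeFn_smul c u).trans (hu.const_smul c)⟩

variable {s : Set ℝ}

/-- The absolutely continuous representative of `u` (determined on `s` only). -/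
def edgeFun (u : edgeDomain s) : ℝ → ℂ := u.2.choose

/-- The derivative of the representative of `u` (determined on `s` only). -/
def edgeDeriv (u : edgeDomain s) : ℝ → ℂ := u.2.choose_spec.choose

/-- The second derivative of the representative of `u` (determined almost everywhere on `s`). -/
def edgeDeriv₂ (u : edgeDomain s) : ℝ → ℂ := u.2.choose_spec.choose_spec.choose

theorem edge_isTwiceAC (u : edgeDomain s) :
    IsTwiceAC s (edgeFun u) (edgeDeriv u) (edgeDeriv₂ u) :=
  u.2.choose_spec.choose_spec.choose_spec.1

theorem edge_ae_eq (u : edgeDomain s) :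
    (u : Lp ℂ 2 (volume.restrict s)) =ᵐ[volume.restrict s] edgeFun u :=
  u.2.choose_spec.choose_spec.choose_spec.2

theorem edge_unique (hs : IsNontrivialInterval s) (u : edgeDomain s) {f f₁ f₂ : ℝ → ℂ}
    (hf : IsTwiceAC s f f₁ f₂)
    (hu : (u : Lp ℂ 2 (volume.restrict s)) =ᵐ[volume.restrict s] f) :
    EqOn (edgeFun u) f s ∧ EqOn (edgeDeriv u) f₁ s ∧
      edgeDeriv₂ u =ᵐ[volume.restrict s] f₂ :=
  (edge_isTwiceAC u).unique hs hf ((edge_ae_eq u).symm.trans hu)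

theorem edge_add (hs : IsNontrivialInterval s) (u v : edgeDomain s) :
    EqOn (edgeFun (u + v)) (edgeFun u + edgeFun v) s ∧
      EqOn (edgeDeriv (u + v)) (edgeDeriv u + edgeDeriv v) s ∧
      edgeDeriv₂ (u + v) =ᵐ[volume.restrict s] edgeDeriv₂ u + edgeDeriv₂ v :=
  edge_unique hs (u + v) ((edge_isTwiceAC u).add (edge_isTwiceAC v))
    ((Lp.coeFn_add (u : Lp ℂ 2 (volume.restrict s)) v).trans ((edge_ae_eq u).add (edge_ae_eq v)))

theorem edge_smul (hs : IsNontrivialInterval s) (c : ℂ) (u : edgeDomain s) :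
    EqOn (edgeFun (c • u)) (c • edgeFun u) s ∧
      EqOn (edgeDeriv (c • u)) (c • edgeDeriv u) s ∧
      edgeDeriv₂ (c • u) =ᵐ[volume.restrict s] c • edgeDeriv₂ u :=
  edge_unique hs (c • u) ((edge_isTwiceAC u).smul c)
    ((Lp.coeFn_smul c (u : Lp ℂ 2 (volume.restrict s))).trans ((edge_ae_eq u).const_smul c))

/-- `u ↦ u(x)`, for a point `x` of the interval `s`. -/
def edgeValue (hs : IsNontrivialInterval s) (x : ℝ) (hx : x ∈ s) : edgeDomain s →ₗ[ℂ] ℂ where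
  toFun u := edgeFun u x
  map_add' u v := (edge_add hs u v).1 hx
  map_smul' c u := (edge_smul hs c u).1 hx

/-- `u ↦ u'(x)`, for a point `x` of the interval `s`. -/
def edgeSlope (hs : IsNontrivialInterval s) (x : ℝ) (hx : x ∈ s) : edgeDomain s →ₗ[ℂ] ℂ where
  toFun u := edgeDeriv u x
  map_add' u v := (edge_add hs u v).2.1 hx
  map_smul' c u := (edge_smul hs c u).2.1 hx

/-- `u ↦ u''` as a map into `L²(s)`. -/
def edgeSecondDeriv (hs : IsNontrivialInterval s) :
    edgeDomain s →ₗ[ℂ] Lp ℂ 2 (volume.restrict s) where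
  toFun u := (edge_isTwiceAC u).memLp.toLp (edgeDeriv₂ u)
  map_add' u v := by
    rw [← MemLp.toLp_add]
    exact MemLp.toLp_congr _ _ (edge_add hs u v).2.2
  map_smul' c u := by
    rw [RingHom.id_apply, ← MemLp.toLp_const_smul]
    exact MemLp.toLp_congr _ _ (edge_smul hs c u).2.2

end Interval

/-! ### Metric graphs and their Laplacians -/

/-- A metric graph with vertex set `V`, set of internal edges `I` and set of external edges `E`.
The graph is finite if the three types are finite. -/
structure MetricGraph (V I E : Type*) where
  /-- The pair of the initial and the terminal vertex of an internal edge. -/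
  bdryInt : I → V × V
  /-- The initial vertex of an external edge. -/
  bdryExt : E → V
  /-- The length of an internal edge. -/
  length : I → ℝ
  length_pos : ∀ i, 0 < length i

namespace MetricGraph

variable {V I E : Type*} (G : MetricGraph V I E)

/-- The interval of an edge: `[0, ∞)` for an external edge, `[0, a_i]` for an internal edge. -/
def interval : E ⊕ I → Set ℝ
  | Sum.inl _ => Ici 0
  | Sum.inr i => Icc 0 (G.length i)

theorem isNontrivialInterval : ∀ j : E ⊕ I, IsNontrivialInterval (G.interval j)
  | Sum.inl _ => isNontrivialInterval_Ici
  | Sum.inr i => isNontrivialInterval_Icc (G.length_pos i)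

theorem zero_mem_interval : ∀ j : E ⊕ I, (0 : ℝ) ∈ G.interval j
  | Sum.inl _ => self_mem_Ici
  | Sum.inr i => left_mem_Icc.2 (G.length_pos i).le

theorem length_mem_interval (i : I) : G.length i ∈ G.interval (Sum.inr i) :=
  right_mem_Icc.2 (G.length_pos i).le

/-- The Hilbert space: the orthogonal sum of the spaces `L²(I_j)` over all edges `j`. -/
abbrev Space : Type _ :=
  PiLp 2 fun j : E ⊕ I => Lp ℂ 2 (volume.restrict (G.interval j))

/-- The boundary space `K = K_E ⊕ K_I⁻ ⊕ K_I⁺`. -/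
abbrev BdrySpace (_G : MetricGraph V I E) : Type _ := EuclideanSpace ℂ (E ⊕ I ⊕ I)

/-- The domain of the maximal operator: all components lie in the edgewise domains. -/
def maxDomain : Submodule ℂ G.Space where
  carrier := {ψ | ∀ j, ψ j ∈ edgeDomain (G.interval j)}
  zero_mem' j := (edgeDomain (G.interval j)).zero_mem
  add_mem' hψ hφ j := (edgeDomain (G.interval j)).add_mem (hψ j) (hφ j)
  smul_mem' c _ hψ j := (edgeDomain (G.interval j)).smul_mem c (hψ j)

/-- The restriction of `ψ` in the maximal domain to the edge `j`. -/
def onEdge (j : E ⊕ I) : G.maxDomain →ₗ[ℂ] edgeDomain (G.interval j) where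
  toFun ψ := ⟨(ψ : G.Space) j, ψ.2 j⟩
  map_add' _ _ := rfl
  map_smul' _ _ := rfl

/-- `ψ ↦ ψ_j(0)`. -/
def valueZero (j : E ⊕ I) : G.maxDomain →ₗ[ℂ] ℂ :=
  edgeValue (G.isNontrivialInterval j) 0 (G.zero_mem_interval j) ∘ₗ G.onEdge j

/-- `ψ ↦ ψ_j'(0)`. -/
def slopeZero (j : E ⊕ I) : G.maxDomain →ₗ[ℂ] ℂ :=
  edgeSlope (G.isNontrivialInterval j) 0 (G.zero_mem_interval j) ∘ₗ G.onEdge j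

/-- `ψ ↦ ψ_i(a_i)`. -/
def valueEnd (i : I) : G.maxDomain →ₗ[ℂ] ℂ :=
  edgeValue (G.isNontrivialInterval (Sum.inr i)) (G.length i) (G.length_mem_interval i) ∘ₗ
    G.onEdge (Sum.inr i)

/-- `ψ ↦ ψ_i'(a_i)`. -/
def slopeEnd (i : I) : G.maxDomain →ₗ[ℂ] ℂ :=
  edgeSlope (G.isNontrivialInterval (Sum.inr i)) (G.length i) (G.length_mem_interval i) ∘ₗ
    G.onEdge (Sum.inr i)

/-- The maximal operator `Δ`, with `(Δ ψ)_j = ψ_j''`. -/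
def laplacian : G.Space →ₗ.[ℂ] G.Space where
  domain := G.maxDomain
  toFun :=
    (WithLp.linearEquiv 2 ℂ (∀ j, Lp ℂ 2 (volume.restrict (G.interval j)))).symm.toLinearMap ∘ₗ
      LinearMap.pi fun j => edgeSecondDeriv (G.isNontrivialInterval j) ∘ₗ G.onEdge j

/-- The domain of the minimal operator: all boundary values and all boundary derivatives vanish. -/
def minDomain : Submodule ℂ G.Space :=
  Submodule.map G.maxDomain.subtype
    { carrier := {ψ | (∀ e : E, G.valueZero (Sum.inl e) ψ = 0 ∧ G.slopeZero (Sum.inl e) ψ = 0) ∧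
        ∀ i : I, G.valueZero (Sum.inr i) ψ = 0 ∧ G.slopeZero (Sum.inr i) ψ = 0 ∧
          G.valueEnd i ψ = 0 ∧ G.slopeEnd i ψ = 0}
      zero_mem' := by simp
      add_mem' := by
        rintro ψ φ ⟨h1, h2⟩ ⟨h3, h4⟩
        refine ⟨fun e => ?_, fun i => ?_⟩
        · simp [h1 e, h3 e]
        · simp [h2 i, h4 i]
      smul_mem' := by
        rintro c ψ ⟨h1, h2⟩
        refine ⟨fun e => ?_, fun i => ?_⟩
        · simp [h1 e]
        · simp [h2 i] }

/-- The minimal operator `Δ⁰`. -/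
def minLaplacian : G.Space →ₗ.[ℂ] G.Space := G.laplacian.domRestrict G.minDomain

/-- The vector of boundary values `(ψ_e(0), ψ_i(0), ψ_i(a_i))`. -/
def bdryValue : G.maxDomain →ₗ[ℂ] G.BdrySpace :=
  (WithLp.linearEquiv 2 ℂ (E ⊕ I ⊕ I → ℂ)).symm.toLinearMap ∘ₗ
    LinearMap.pi fun k => match k with
      | Sum.inl e => G.valueZero (Sum.inl e)
      | Sum.inr (Sum.inl i) => G.valueZero (Sum.inr i)
      | Sum.inr (Sum.inr i) => G.valueEnd i

/-- The vector of inward boundary derivatives `(ψ_e'(0), ψ_i'(0), -ψ_i'(a_i))`. -/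
def bdryDeriv : G.maxDomain →ₗ[ℂ] G.BdrySpace :=
  (WithLp.linearEquiv 2 ℂ (E ⊕ I ⊕ I → ℂ)).symm.toLinearMap ∘ₗ
    LinearMap.pi fun k => match k with
      | Sum.inl e => G.slopeZero (Sum.inl e)
      | Sum.inr (Sum.inl i) => G.slopeZero (Sum.inr i)
      | Sum.inr (Sum.inr i) => -G.slopeEnd i

/-- The full boundary map `[ψ] ∈ K²`. -/
def bdryMap : G.maxDomain →ₗ[ℂ] G.BdrySpace × G.BdrySpace :=
  G.bdryValue.prod G.bdryDeriv

/-- The operator `-Δ(M)`: the restriction of `-Δ` to all `ψ` in the maximal domain with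
`[ψ] ∈ M`. -/
def negLaplacianOn (M : Submodule ℂ (G.BdrySpace × G.BdrySpace)) : G.Space →ₗ.[ℂ] G.Space :=
  (-G.laplacian).domRestrict ((M.comap G.bdryMap).map G.maxDomain.subtype)

/-- The subspace `M(A, B)`: the kernel of `(A, B) : K² → K`, `(χ₁, χ₂) ↦ A χ₁ + B χ₂`. -/
def bdryKer (A B : G.BdrySpace →ₗ[ℂ] G.BdrySpace) : Submodule ℂ (G.BdrySpace × G.BdrySpace) :=
  LinearMap.ker (A.coprod B)

/-- The operator `-Δ(A, B)`, with boundary conditions `A ψ + B ψ' = 0`. -/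
def negLaplacianAB (A B : G.BdrySpace →ₗ[ℂ] G.BdrySpace) : G.Space →ₗ.[ℂ] G.Space :=
  G.negLaplacianOn (G.bdryKer A B)

end MetricGraph

end

/-!
Let `T` be an operator between `-Δ⁰` and `-Δ`. The boundary map `ψ ↦ [ψ]` from the maximal domain to
`K × K` is onto and its kernel is the minimal domain, so `T = -Δ(M)` for a subspace `M` of `K × K`
(`eq_negLaplacianOn`). Write `P` for the domain `{χ₁ | (χ₁, χ₂) ∈ M}` of the linear relation `M` and
`M₀ = {η | (0, η) ∈ M}` for its multivalued part. If `M₀ = Pᗮ`, then `dim M = dim K`, and `M` is the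
kernel of a surjective map `(A, B) : K × K → K`. Thus the point is that `M₀ = Pᗮ` when `-Δ(M)` is
quasi-m-accretive.

Integration by parts gives `Re ⟨ψ, -Δψ⟩ = ‖ψ'‖² + Re ⟨ψ, ψ'⟩_K` with boundary values in the last
term. Two consequences of it are used.

* A boundary slope can be prescribed, with boundary value zero, at an arbitrarily small cost in
  `‖ψ‖` and in the form (`exists_small`). Hence quasi-accretivity bounds
  `t ↦ Re ⟨χ₁, χ₂ + t η⟩` from below for `χ ∈ M`, `η ∈ M₀`, and so `M₀ ⊆ Pᗮ`
  (`inner_eq_zero_of_isQuasiAccretive`).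
* By the trace inequality `exists_le_norm_sq_sub_inner`, `-Δ(N)` is quasi-accretive as soon as
  `Re ⟨χ₁, χ₂⟩ ≥ -c ‖χ₁‖²` on `N`. Since `M₀ ⊆ Pᗮ`, this bound holds on `M`, because `χ₂` is a
  linear function of `χ₁` modulo `M₀`; and it persists on `N = M + 0 × Pᗮ`. Maximality then gives
  `N = M`, which is to say `Pᗮ ⊆ M₀` (`mem_iff_mem_orthogonal_of_isQuasiMAccretive`).

On a half-line neither `ψ' ∈ L²` nor the decay of `ψ` at infinity is proved: it is enough that the
boundary term at `X` does not stay above a positive number as `X → ∞` (`IsTwiceAC.exists_inner_lt`).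

On `ℂ`, the real inner product `inner ℝ z w` is `Re (conj z * w)`.
-/

/-! ### Absolutely continuous functions on an interval -/

theorem AbsolutelyContinuousOnInterval.comp_lipschitz {X Y : Type*} [PseudoMetricSpace X]
    [PseudoMetricSpace Y] {f : ℝ → X} {g : X → Y} {a b : ℝ} (hg : LipschitzWith 1 g)
    (hf : AbsolutelyContinuousOnInterval f a b) :
    AbsolutelyContinuousOnInterval (fun x => g (f x)) a b := by
  rw [absolutelyContinuousOnInterval_iff] at hf ⊢
  intro ε hε
  obtain ⟨δ, hδ, h⟩ := hf ε hε
  refine ⟨δ, hδ, fun J hJ hJδ => lt_of_le_of_lt (Finset.sum_le_sum fun i _ => ?_) (h J hJ hJδ)⟩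
  simpa using hg.dist_le_mul (f (J.2 i).1) (f (J.2 i).2)

theorem AbsolutelyContinuousOnInterval.inner_complex {f g : ℝ → ℂ} {a b : ℝ}
    (hf : AbsolutelyContinuousOnInterval f a b) (hg : AbsolutelyContinuousOnInterval g a b) :
    AbsolutelyContinuousOnInterval (fun x => inner ℝ (f x) (g x)) a b := by
  have hre : LipschitzWith 1 Complex.re :=
    LipschitzWith.of_dist_le_mul fun z w => by
      simpa [Real.dist_eq, dist_eq_norm] using Complex.abs_re_le_norm (z - w)
  have him : LipschitzWith 1 Complex.im :=
    LipschitzWith.of_dist_le_mul fun z w => by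
      simpa [Real.dist_eq, dist_eq_norm] using Complex.abs_im_le_norm (z - w)
  have h : (fun x => (inner ℝ (f x) (g x) : ℝ)) =
      (fun x => (f x).re) * (fun x => (g x).re) + (fun x => (f x).im) * (fun x => (g x).im) := by
    ext x
    simp [Complex.inner, Complex.mul_re]
    ring
  rw [h]
  exact ((hf.comp_lipschitz hre).mul (hg.comp_lipschitz hre)).add
    ((hf.comp_lipschitz him).mul (hg.comp_lipschitz him))

/-- The fundamental theorem of calculus for an absolutely continuous function, in terms of a given
almost everywhere derivative. -/
theorem AbsolutelyContinuousOnInterval.integral_eq_sub_of_hasDerivWithinAt {F D : ℝ → ℝ} {b : ℝ}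
    (hb : 0 ≤ b) (hF : AbsolutelyContinuousOnInterval F 0 b)
    (hD : ∀ᵐ x ∂volume.restrict (Icc 0 b), HasDerivWithinAt F (D x) (Icc 0 b) x) :
    IntervalIntegrable D volume 0 b ∧ ∫ x in (0 : ℝ)..b, D x = F b - F 0 := by
  have h : deriv F =ᵐ[volume.restrict (Ioc 0 b)] D := by
    rw [← Measure.restrict_congr_set Ioo_ae_eq_Icc] at hD
    rw [← Measure.restrict_congr_set Ioo_ae_eq_Ioc]
    filter_upwards [hD, ae_restrict_mem measurableSet_Ioo] with x hx hxm
    exact (hx.hasDerivAt (Icc_mem_nhds hxm.1 hxm.2)).deriv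
  have h' : ∀ᵐ x, x ∈ uIoc 0 b → deriv F x = D x := by
    rw [uIoc_of_le hb]
    exact (ae_restrict_iff' measurableSet_Ioc).1 h
  refine ⟨hF.intervalIntegrable_deriv.congr_ae ?_, ?_⟩
  · rwa [uIoc_of_le hb]
  · rw [← hF.integral_deriv_eq_sub]
    exact (intervalIntegral.integral_congr_ae h').symm

theorem IsTwiceAC.mono {s t : Set ℝ} {f f₁ f₂ : ℝ → ℂ} (hf : IsTwiceAC s f f₁ f₂) (hts : t ⊆ s) :
    IsTwiceAC t f f₁ f₂ where
  ac a ha b hb := hf.ac a (hts ha) b (hts hb)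
  hasDeriv x hx := (hf.hasDeriv x (hts hx)).mono hts
  ac_deriv a ha b hb := hf.ac_deriv a (hts ha) b (hts hb)
  hasDeriv_deriv :=
    (ae_restrict_of_ae_restrict_of_subset hts hf.hasDeriv_deriv).mono fun _ hx => hx.mono hts
  memLp := hf.memLp.mono_measure (Measure.restrict_mono hts le_rfl)

theorem IsTwiceAC.continuousOn {s : Set ℝ} {f f₁ f₂ : ℝ → ℂ} (hf : IsTwiceAC s f f₁ f₂) :
    ContinuousOn f s := fun x hx => (hf.hasDeriv x hx).continuousWithinAt

theorem integrable_inner_of_memLp {α : Type*} [MeasurableSpace α] {μ : Measure α} {f g : α → ℂ}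
    (hf : MemLp f 2 μ) (hg : MemLp g 2 μ) : Integrable (fun x => (inner ℝ (f x) (g x) : ℝ)) μ := by
  refine (L2.integrable_inner (𝕜 := ℝ) (hf.toLp f) (hg.toLp g)).congr ?_
  filter_upwards [hf.coeFn_toLp, hg.coeFn_toLp] with x h1 h2
  rw [h1, h2]

theorem memLp_of_continuousOn_Icc {f : ℝ → ℂ} {a b : ℝ} (hf : ContinuousOn f (Icc a b)) :
    MemLp f 2 (volume.restrict (Icc a b)) := by
  obtain ⟨C, hC⟩ := isCompact_Icc.exists_bound_of_continuousOn hf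
  exact MemLp.of_bound (hf.aestronglyMeasurable measurableSet_Icc) C
    ((ae_restrict_mem measurableSet_Icc).mono hC)

theorem IsTwiceAC.intervalIntegrable_inner {b : ℝ} (hb : 0 ≤ b) {f f₁ f₂ g g₁ g₂ : ℝ → ℂ}
    (hf : IsTwiceAC (Icc 0 b) f f₁ f₂) (hg : IsTwiceAC (Icc 0 b) g g₁ g₂) :
    IntervalIntegrable (fun x => inner ℝ (f x) (g₂ x)) volume 0 b := by
  rw [intervalIntegrable_iff_integrableOn_Icc_of_le hb]
  exact integrable_inner_of_memLp (memLp_of_continuousOn_Icc hf.continuousOn) hg.memLp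

/-- Green's second identity on `[0, b]`. -/
theorem IsTwiceAC.green {b : ℝ} (hb : 0 ≤ b) {f f₁ f₂ g g₁ g₂ : ℝ → ℂ}
    (hf : IsTwiceAC (Icc 0 b) f f₁ f₂) (hg : IsTwiceAC (Icc 0 b) g g₁ g₂) :
    ∫ x in (0 : ℝ)..b, ((inner ℝ (f x) (g₂ x) : ℝ) - inner ℝ (f₂ x) (g x)) =
      ((inner ℝ (f b) (g₁ b) : ℝ) - inner ℝ (f₁ b) (g b)) -
        ((inner ℝ (f 0) (g₁ 0) : ℝ) - inner ℝ (f₁ 0) (g 0)) := by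
  have h0 : (0 : ℝ) ∈ Icc 0 b := left_mem_Icc.2 hb
  have h1 : b ∈ Icc 0 b := right_mem_Icc.2 hb
  refine (AbsolutelyContinuousOnInterval.integral_eq_sub_of_hasDerivWithinAt hb
    (((hf.ac 0 h0 b h1).inner_complex (hg.ac_deriv 0 h0 b h1)).sub
      ((hf.ac_deriv 0 h0 b h1).inner_complex (hg.ac 0 h0 b h1))) ?_).2
  filter_upwards [hf.hasDeriv_deriv, hg.hasDeriv_deriv, ae_restrict_mem measurableSet_Icc]
    with x hfx hgx hx
  exact (((hf.hasDeriv x hx).inner ℝ hgx).sub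
    (hfx.inner ℝ (hg.hasDeriv x hx))).congr_deriv (by ring)

/-- A lower bound for `-∫ Re (conj f f'')`. With a weight `w`, the derivative of
`Re (conj f f') + w |f|²` is `|f' + w f|² + (w' - w²) |f|² + Re (conj f f'')`, so that the first
term may be dropped. -/
theorem IsTwiceAC.le_integral {b c m K : ℝ} (hb : 0 ≤ b) {f f₁ f₂ : ℝ → ℂ}
    (hf : IsTwiceAC (Icc 0 b) f f₁ f₂) (hK : ∀ x ∈ Icc 0 b, (c + m * x) ^ 2 - m ≤ K) :
    ((inner ℝ (f 0) (f₁ 0) : ℝ) + c * ‖f 0‖ ^ 2) -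
        ((inner ℝ (f b) (f₁ b) : ℝ) + (c + m * b) * ‖f b‖ ^ 2) ≤
      ∫ x in (0 : ℝ)..b, (-(inner ℝ (f x) (f₂ x) : ℝ) + K * ‖f x‖ ^ 2) := by
  have h0 : (0 : ℝ) ∈ Icc 0 b := left_mem_Icc.2 hb
  have h1 : b ∈ Icc 0 b := right_mem_Icc.2 hb
  have hw : AbsolutelyContinuousOnInterval (fun x : ℝ => c + m * x) 0 b :=
    ContDiffOn.absolutelyContinuousOnInterval (by fun_prop)
  have hac := ((hf.ac 0 h0 b h1).inner_complex (hf.ac_deriv 0 h0 b h1)).add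
    (hw.mul ((hf.ac 0 h0 b h1).inner_complex (hf.ac 0 h0 b h1)))
  obtain ⟨hint, heq⟩ := hac.integral_eq_sub_of_hasDerivWithinAt
    (D := fun x => ((inner ℝ (f x) (f₂ x) : ℝ) + inner ℝ (f₁ x) (f₁ x)) +
      (m * (inner ℝ (f x) (f x) : ℝ) + (c + m * x) *
        ((inner ℝ (f x) (f₁ x) : ℝ) + inner ℝ (f₁ x) (f x)))) hb (by
    filter_upwards [hf.hasDeriv_deriv, ae_restrict_mem measurableSet_Icc] with x hfx hx
    have hwx : HasDerivWithinAt (fun x : ℝ => c + m * x) m (Icc 0 b) x := by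
      simpa using ((hasDerivWithinAt_id x (Icc 0 b)).const_mul m).const_add c
    exact ((hf.hasDeriv x hx).inner ℝ hfx).add
      (hwx.mul ((hf.hasDeriv x hx).inner ℝ (hf.hasDeriv x hx))))
  have hsq : IntervalIntegrable (fun x => K * ‖f x‖ ^ 2) volume 0 b := by
    refine ContinuousOn.intervalIntegrable ?_
    rw [uIcc_of_le hb]
    exact continuousOn_const.mul (hf.continuousOn.norm.pow 2)
  have hmono := intervalIntegral.integral_mono_on hb hint.neg
    ((hf.intervalIntegrable_inner hb hf).neg.add hsq) (by
      intro x hx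
      have h2 : (0 : ℝ) ≤ ‖f₁ x + (c + m * x) • f x‖ ^ 2 := by positivity
      rw [norm_add_sq_real, inner_smul_right, norm_smul, mul_pow, Real.norm_eq_abs, sq_abs] at h2
      have h3 := mul_le_mul_of_nonneg_right (hK x hx) (sq_nonneg ‖f x‖)
      have h4 := real_inner_comm (f x) (f₁ x)
      simp only [Pi.neg_apply, real_inner_self_eq_norm_sq]
      rw [h4] at h2 ⊢
      linarith)
  have hneg : ∫ x in (0 : ℝ)..b, (-fun x => ((inner ℝ (f x) (f₂ x) : ℝ) + inner ℝ (f₁ x) (f₁ x)) +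
      (m * (inner ℝ (f x) (f x) : ℝ) + (c + m * x) *
        ((inner ℝ (f x) (f₁ x) : ℝ) + inner ℝ (f₁ x) (f x)))) x =
      ((inner ℝ (f 0) (f₁ 0) : ℝ) + c * ‖f 0‖ ^ 2) -
        ((inner ℝ (f b) (f₁ b) : ℝ) + (c + m * b) * ‖f b‖ ^ 2) := by
    simp only [Pi.neg_apply, intervalIntegral.integral_neg, heq]
    simp
  exact hneg ▸ hmono

/-- Along an `L²` function on the half-line, `Re (conj f f') + c |f|²` is not eventually bounded
below by a positive number: otherwise `|f|²` would grow linearly. -/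
theorem IsTwiceAC.exists_inner_lt {c δ X₀ : ℝ} (hc : 0 ≤ c) (hδ : 0 < δ) {f f₁ f₂ : ℝ → ℂ}
    (hf : IsTwiceAC (Ici 0) f f₁ f₂) (hf2 : MemLp f 2 (volume.restrict (Ici 0))) :
    ∃ X ≥ X₀, 0 ≤ X ∧ (inner ℝ (f X) (f₁ X) : ℝ) + c * ‖f X‖ ^ 2 < δ := by
  by_contra! h
  set u : ℝ → ℝ := fun x => ‖f x‖ ^ 2 with hu
  have hui : IntegrableOn u (Ici 0) := by
    simpa [hu, IntegrableOn] using integrable_inner_of_memLp hf2 hf2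
  set N := ∫ x in Ici 0, u x with hN
  set Y := max X₀ 0 with hY
  have hY0 : 0 ≤ Y := le_max_right _ _
  have hf1c : ContinuousOn f₁ (Ici 0) := fun x hx =>
    ((hf.ac_deriv 0 self_mem_Ici (x + 1) (by simp only [mem_Ici] at hx ⊢; linarith)).continuousOn x
      (by rw [uIcc_of_le (by simp only [mem_Ici] at hx; linarith)]; exact ⟨hx, by linarith⟩)
      ).mono_of_mem_nhdsWithin (by
        rw [uIcc_of_le (by simp only [mem_Ici] at hx; linarith)]
        rw [← Ici_inter_Iic]
        exact inter_mem_nhdsWithin _ (Iic_mem_nhds (by linarith)))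
  -- The derivative of `|f|²` is `2 Re (conj f f') ≥ 2 δ - 2 c |f|²`, and `|f|²` is integrable.
  have hgrow : ∀ X ≥ Y, 2 * δ * (X - Y) - 2 * c * N ≤ u X := by
    intro X hX
    have hsub : Icc Y X ⊆ Ici 0 := fun x hx => hY0.trans hx.1
    have hcont : ContinuousOn (fun x => 2 * (inner ℝ (f x) (f₁ x) : ℝ)) (Icc Y X) :=
      continuousOn_const.mul ((hf.continuousOn.mono hsub).inner (hf1c.mono hsub))
    have hftc : ∫ x in Y..X, 2 * (inner ℝ (f x) (f₁ x) : ℝ) = u X - u Y := by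
      refine intervalIntegral.integral_eq_sub_of_hasDerivAt_of_le hX
        ((hf.continuousOn.mono hsub).norm.pow 2) (fun x hx => ?_)
        (ContinuousOn.intervalIntegrable (by rwa [uIcc_of_le hX]))
      have hx0 : 0 < x := hY0.trans_lt hx.1
      exact ((hf.hasDeriv x hx0.le).hasDerivAt (Ici_mem_nhds hx0)).norm_sq
    have huI : IntervalIntegrable u volume Y X := by
      refine ContinuousOn.intervalIntegrable ?_
      rw [uIcc_of_le hX]
      exact (hf.continuousOn.mono hsub).norm.pow 2
    have hle : ∫ x in Y..X, (2 * δ - 2 * c * u x) ≤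
        ∫ x in Y..X, 2 * (inner ℝ (f x) (f₁ x) : ℝ) := by
      refine intervalIntegral.integral_mono_on hX
        (intervalIntegrable_const.sub (huI.const_mul _))
        (ContinuousOn.intervalIntegrable (by rwa [uIcc_of_le hX])) fun x hx => ?_
      have := h x ((le_max_left _ _).trans hx.1) (hY0.trans hx.1)
      simp only [hu]
      linarith
    rw [intervalIntegral.integral_sub intervalIntegrable_const (huI.const_mul _),
      intervalIntegral.integral_const, intervalIntegral.integral_const_mul, hftc] at hle
    have hNle : ∫ x in Y..X, u x ≤ N := by
      rw [intervalIntegral.integral_of_le hX]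
      refine setIntegral_mono_set hui (Filter.Eventually.of_forall fun x => ?_) ?_
      · simp only [hu, Pi.zero_apply]; positivity
      · exact (Ioc_subset_Icc_self.trans hsub).eventuallyLE
    have := mul_le_mul_of_nonneg_left hNle (by positivity : 0 ≤ 2 * c)
    have h0 : 0 ≤ u Y := by simp only [hu]; positivity
    simp only [smul_eq_mul] at hle
    linarith
  set Z := max Y (Y + (1 + 2 * c * N) / (2 * δ)) with hZ
  have hone : ∀ x ∈ Ici Z, 1 ≤ u x := by
    intro x hx
    have h1 := hgrow x ((le_max_left _ _).trans hx)
    have h2 : (1 + 2 * c * N) / (2 * δ) ≤ x - Y := by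
      have := (le_max_right Y (Y + (1 + 2 * c * N) / (2 * δ))).trans hx
      linarith
    rw [div_le_iff₀ (by positivity)] at h2
    linarith
  have hint : IntegrableOn (fun _ : ℝ => (1 : ℝ)) (Ici Z) := by
    refine Integrable.mono' (hui.mono_set (Ici_subset_Ici.2 (hY0.trans (le_max_left _ _))))
      aestronglyMeasurable_const ?_
    filter_upwards [ae_restrict_mem measurableSet_Ici] with x hx
    simpa using hone x hx
  rw [integrableOn_const_iff] at hint
  simp at hint

/-! ### Test functions near a boundary point -/

theorem hasDerivAt_max_zero_pow (n : ℕ) (t : ℝ) :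
    HasDerivAt (fun t : ℝ => max 0 t ^ (n + 2)) ((n + 2 : ℝ) * max 0 t ^ (n + 1)) t := by
  rcases lt_trichotomy t 0 with ht | rfl | ht
  · rw [max_eq_left ht.le]
    have h : (fun t : ℝ => max 0 t ^ (n + 2)) =ᶠ[nhds t] fun _ => 0 := by
      filter_upwards [Iio_mem_nhds ht] with x hx
      rw [max_eq_left (le_of_lt hx)]
      simp
    simpa using (hasDerivAt_const t (0 : ℝ)).congr_of_eventuallyEq h
  · rw [hasDerivAt_iff_isLittleO_nhds_zero]
    simp only [zero_add, max_self, smul_eq_mul, ne_eq, Nat.add_eq_zero_iff, OfNat.ofNat_ne_zero,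
      one_ne_zero, and_false, not_false_eq_true, zero_pow, sub_zero, mul_zero]
    refine Asymptotics.IsBigO.trans_isLittleO (g := fun h : ℝ => h ^ (n + 2)) ?_
      (by simpa using Asymptotics.isLittleO_pow_id (𝕜 := ℝ) (n := n + 2) (by omega))
    refine Asymptotics.IsBigO.of_bound 1 (Filter.Eventually.of_forall fun x => ?_)
    rw [one_mul, norm_pow, norm_pow]
    refine pow_le_pow_left₀ (norm_nonneg _) ?_ _
    rw [Real.norm_eq_abs, Real.norm_eq_abs, abs_of_nonneg (le_max_left _ _)]
    exact max_le (abs_nonneg x) (le_abs_self x)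
  · rw [max_eq_right ht.le]
    have h : (fun t : ℝ => max 0 t ^ (n + 2)) =ᶠ[nhds t] fun t => t ^ (n + 2) := by
      filter_upwards [Ioi_mem_nhds ht] with x hx
      rw [max_eq_right (le_of_lt hx)]
    simpa using (hasDerivAt_pow (n + 2) t).congr_of_eventuallyEq h

/-- The function `(1 - x / ε)₊`. -/
noncomputable def taper (ε x : ℝ) : ℝ := max 0 (1 - x / ε)

theorem continuous_taper (ε : ℝ) : Continuous (taper ε) := by unfold taper; fun_prop

theorem taper_nonneg (ε x : ℝ) : 0 ≤ taper ε x := le_max_left _ _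

theorem taper_le_one {ε x : ℝ} (hε : 0 < ε) (hx : 0 ≤ x) : taper ε x ≤ 1 :=
  max_le zero_le_one (by linarith [div_nonneg hx hε.le])

theorem taper_zero (ε : ℝ) : taper ε 0 = 1 := by simp [taper]

theorem taper_eq_zero {ε x : ℝ} (hε : 0 < ε) (hx : ε ≤ x) : taper ε x = 0 :=
  max_eq_left (by rw [sub_nonpos, one_le_div hε]; exact hx)

theorem hasDerivAt_taper_pow (ε : ℝ) (n : ℕ) (x : ℝ) :
    HasDerivAt (fun x => taper ε x ^ (n + 2)) (-((n + 2 : ℝ) / ε) * taper ε x ^ (n + 1)) x := by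
  have h1 : HasDerivAt (fun x : ℝ => 1 - x / ε) (-(1 / ε)) x :=
    ((hasDerivAt_id x).div_const ε).const_sub 1
  refine ((hasDerivAt_max_zero_pow n (1 - x / ε)).comp x h1).congr_deriv ?_
  simp only [taper]
  ring

/-- A `C²` function supported in `x ≤ ε`, with value `α` and derivative `β` at `0`. The cube of
`taper` makes it `C²` at `ε`; the summand `3 α / ε` offsets the slope of that cube at `0`. -/
noncomputable def cornerFun (α β : ℂ) (ε x : ℝ) : ℂ := (α + (β + 3 * α / ε) * x) * (taper ε x ^ 3 : ℝ)

/-- The derivative of `cornerFun`. -/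
noncomputable def cornerDeriv (α β : ℂ) (ε x : ℝ) : ℂ :=
  (β + 3 * α / ε) * (taper ε x ^ 3 : ℝ) +
    (α + (β + 3 * α / ε) * x) * (-(3 / ε) * taper ε x ^ 2 : ℝ)

/-- The second derivative of `cornerFun`. -/
noncomputable def cornerDeriv₂ (α β : ℂ) (ε x : ℝ) : ℂ :=
  2 * (β + 3 * α / ε) * (-(3 / ε) * taper ε x ^ 2 : ℝ) +
    (α + (β + 3 * α / ε) * x) * (6 / ε ^ 2 * taper ε x : ℝ)

section Corner

variable (α β : ℂ) {ε : ℝ}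

theorem hasDerivAt_cornerFun (x : ℝ) :
    HasDerivAt (cornerFun α β ε) (cornerDeriv α β ε x) x := by
  have h1 : HasDerivAt (fun x : ℝ => α + (β + 3 * α / ε) * (x : ℂ)) (β + 3 * α / ε) x := by
    simpa using ((Complex.ofRealCLM.hasDerivAt (x := x)).const_mul (β + 3 * α / ε)).const_add α
  have h2 := (hasDerivAt_taper_pow ε 1 x).ofReal_comp
  refine (h1.mul h2).congr_deriv ?_
  simp only [cornerDeriv]
  push_cast
  ring

theorem hasDerivAt_cornerDeriv (x : ℝ) :
    HasDerivAt (cornerDeriv α β ε) (cornerDeriv₂ α β ε x) x := by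
  have h1 : HasDerivAt (fun x : ℝ => α + (β + 3 * α / ε) * (x : ℂ)) (β + 3 * α / ε) x := by
    simpa using ((Complex.ofRealCLM.hasDerivAt (x := x)).const_mul (β + 3 * α / ε)).const_add α
  have h2 := (hasDerivAt_taper_pow ε 1 x).ofReal_comp
  have h3 := ((hasDerivAt_taper_pow ε 0 x).const_mul (-(3 / ε))).ofReal_comp
  refine ((h2.const_mul (β + 3 * α / ε)).add (h1.mul h3)).congr_deriv ?_
  simp only [cornerDeriv₂]
  push_cast
  ring

theorem continuous_cornerDeriv₂ : Continuous (cornerDeriv₂ α β ε) := by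
  have := continuous_taper ε
  unfold cornerDeriv₂
  fun_prop

theorem cornerFun_zero : cornerFun α β ε 0 = α := by simp [cornerFun, taper_zero]

theorem cornerDeriv_zero : cornerDeriv α β ε 0 = β := by
  simp only [cornerDeriv, taper_zero]
  push_cast
  ring

theorem cornerFun_eq_zero {x : ℝ} (hε : 0 < ε) (hx : ε ≤ x) : cornerFun α β ε x = 0 := by
  simp [cornerFun, taper_eq_zero hε hx]

theorem cornerDeriv_eq_zero {x : ℝ} (hε : 0 < ε) (hx : ε ≤ x) : cornerDeriv α β ε x = 0 := by
  simp [cornerDeriv, taper_eq_zero hε hx]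

theorem cornerDeriv₂_eq_zero {x : ℝ} (hε : 0 < ε) (hx : ε ≤ x) : cornerDeriv₂ α β ε x = 0 := by
  simp [cornerDeriv₂, taper_eq_zero hε hx]

theorem norm_cornerFun_le {x : ℝ} (hε : 0 < ε) (hx : 0 ≤ x) :
    ‖cornerFun 0 β ε x‖ ≤ ε * ‖β‖ := by
  rcases le_total ε x with h | h
  · rw [cornerFun_eq_zero 0 β hε h, norm_zero]; positivity
  · simp only [cornerFun, mul_zero, zero_div, add_zero, zero_add, norm_mul, Complex.norm_real,
      Real.norm_eq_abs, abs_of_nonneg hx, abs_of_nonneg (pow_nonneg (taper_nonneg ε x) 3)]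
    have h3 : taper ε x ^ 3 ≤ 1 := pow_le_one₀ (taper_nonneg ε x) (taper_le_one hε hx)
    have h0 := taper_nonneg ε x
    calc ‖β‖ * x * taper ε x ^ 3 ≤ ‖β‖ * ε * 1 := by gcongr
      _ = ε * ‖β‖ := by ring

theorem norm_cornerDeriv₂_le {x : ℝ} (hε : 0 < ε) (hx : 0 ≤ x) :
    ‖cornerDeriv₂ 0 β ε x‖ ≤ 12 * ‖β‖ / ε := by
  rcases le_total ε x with h | h
  · rw [cornerDeriv₂_eq_zero 0 β hε h, norm_zero]; positivity
  · have h1 := taper_le_one hε hx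
    have h0 := taper_nonneg ε x
    have h2 : taper ε x ^ 2 ≤ 1 := pow_le_one₀ h0 h1
    simp only [cornerDeriv₂, mul_zero, zero_div, add_zero, zero_add]
    refine (norm_add_le _ _).trans ?_
    simp only [norm_mul, Complex.norm_real, Real.norm_eq_abs, abs_neg, abs_div, abs_pow,
      abs_of_nonneg hx, abs_of_pos hε, abs_of_nonneg h0, Complex.norm_ofNat, Nat.abs_ofNat]
    calc 2 * ‖β‖ * (3 / ε * taper ε x ^ 2) + ‖β‖ * x * (6 / ε ^ 2 * taper ε x)
        ≤ 2 * ‖β‖ * (3 / ε * 1) + ‖β‖ * ε * (6 / ε ^ 2 * 1) := by gcongr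
      _ = 12 * ‖β‖ / ε := by field_simp; ring

end Corner

theorem AbsolutelyContinuousOnInterval.of_hasDerivAt {f f₁ : ℝ → ℂ}
    (hf : ∀ x, HasDerivAt f (f₁ x) x) (hf₁ : Continuous f₁) (a b : ℝ) :
    AbsolutelyContinuousOnInterval f a b := by
  refine ContDiffOn.absolutelyContinuousOnInterval (ContDiff.contDiffOn ?_)
  rw [contDiff_one_iff_deriv]
  refine ⟨fun x => (hf x).differentiableAt, ?_⟩
  rwa [show deriv f = f₁ from funext fun x => (hf x).deriv]

theorem memLp_of_continuous_of_eq_zero {s : Set ℝ} (hs : MeasurableSet s) {R : ℝ} {f : ℝ → ℂ}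
    (hf : Continuous f) (h0 : ∀ x ∈ s, x ∉ Icc 0 R → f x = 0) :
    MemLp f 2 (volume.restrict s) := by
  have h1 : MemLp ((Icc 0 R).indicator f) 2 (volume.restrict s) :=
    ((memLp_indicator_iff_restrict measurableSet_Icc).2
      (memLp_of_continuousOn_Icc hf.continuousOn)).mono_measure Measure.restrict_le_self
  refine h1.ae_eq ?_
  filter_upwards [ae_restrict_mem hs] with x hx
  by_cases hxR : x ∈ Icc 0 R
  · rw [indicator_of_mem hxR]
  · rw [indicator_of_notMem hxR, h0 x hx hxR]

/-- A `C²` function whose second derivative vanishes on `s` outside a compact interval. -/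
theorem IsTwiceAC.of_hasDerivAt {s : Set ℝ} (hs : MeasurableSet s) {R : ℝ} {f f₁ f₂ : ℝ → ℂ}
    (hf : ∀ x, HasDerivAt f (f₁ x) x) (hf₁ : ∀ x, HasDerivAt f₁ (f₂ x) x) (hf₂ : Continuous f₂)
    (h0 : ∀ x ∈ s, x ∉ Icc 0 R → f₂ x = 0) : IsTwiceAC s f f₁ f₂ where
  ac a _ b _ := .of_hasDerivAt hf
    (continuous_iff_continuousAt.2 fun x => (hf₁ x).continuousAt) a b
  hasDeriv x _ := (hf x).hasDerivWithinAt
  ac_deriv a _ b _ := .of_hasDerivAt hf₁ hf₂ a b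
  hasDeriv_deriv := Filter.Eventually.of_forall fun x => (hf₁ x).hasDerivWithinAt
  memLp := memLp_of_continuous_of_eq_zero hs hf₂ h0

/-- The element of the edge domain represented by a given function. -/
theorem exists_edgeDomain {s : Set ℝ} (hs : IsNontrivialInterval s) {f f₁ f₂ : ℝ → ℂ}
    (hf : IsTwiceAC s f f₁ f₂) (hf2 : MemLp f 2 (volume.restrict s)) :
    ∃ u : edgeDomain s, EqOn (edgeFun u) f s ∧ EqOn (edgeDeriv u) f₁ s ∧
      edgeDeriv₂ u =ᵐ[volume.restrict s] f₂ :=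
  let u : edgeDomain s := ⟨hf2.toLp f, f, f₁, f₂, hf, hf2.coeFn_toLp⟩
  ⟨u, edge_unique hs u hf hf2.coeFn_toLp⟩

/-! ### The operator on a single edge -/

section Edge

variable {s : Set ℝ}

theorem re_inner_Lp_eq {F G : Lp ℂ 2 (volume.restrict s)} {f g : ℝ → ℂ}
    (hF : F =ᵐ[volume.restrict s] f) (hG : G =ᵐ[volume.restrict s] g) :
    (inner ℂ F G).re = ∫ x in s, (inner ℝ (f x) (g x) : ℝ) := by
  rw [L2.inner_def]
  have h := integral_re (𝕜 := ℂ) (L2.integrable_inner (𝕜 := ℂ) F G)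
  rw [← RCLike.re_eq_complex_re, ← h]
  refine integral_congr_ae ?_
  filter_upwards [hF, hG] with x h1 h2
  rw [h1, h2]
  rfl

theorem memLp_edgeFun (u : edgeDomain s) : MemLp (edgeFun u) 2 (volume.restrict s) :=
  (Lp.memLp (u : Lp ℂ 2 (volume.restrict s))).ae_eq (edge_ae_eq u)

theorem re_inner_edgeSecondDeriv (hs : IsNontrivialInterval s) (u v : edgeDomain s) :
    (inner ℂ (u : Lp ℂ 2 (volume.restrict s)) (edgeSecondDeriv hs v)).re =
      ∫ x in s, (inner ℝ (edgeFun u x) (edgeDeriv₂ v x) : ℝ) :=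
  re_inner_Lp_eq (edge_ae_eq u) (edge_isTwiceAC v).memLp.coeFn_toLp

theorem norm_sq_edge (u : edgeDomain s) :
    ‖(u : Lp ℂ 2 (volume.restrict s))‖ ^ 2 = ∫ x in s, ‖edgeFun u x‖ ^ 2 := by
  rw [← inner_self_eq_norm_sq (𝕜 := ℂ), RCLike.re_eq_complex_re,
    re_inner_Lp_eq (edge_ae_eq u) (edge_ae_eq u)]
  simp only [real_inner_self_eq_norm_sq]

theorem integrable_norm_sq_edge (u : edgeDomain s) :
    IntegrableOn (fun x => ‖edgeFun u x‖ ^ 2) s := by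
  simpa [IntegrableOn] using integrable_inner_of_memLp (memLp_edgeFun u) (memLp_edgeFun u)

theorem integrable_inner_edge (u v : edgeDomain s) :
    IntegrableOn (fun x => (inner ℝ (edgeFun u x) (edgeDeriv₂ v x) : ℝ)) s :=
  integrable_inner_of_memLp (memLp_edgeFun u) (edge_isTwiceAC v).memLp

theorem setIntegral_neg_inner_add (hs : IsNontrivialInterval s) (K : ℝ) (u : edgeDomain s) :
    ∫ x in s, (-(inner ℝ (edgeFun u x) (edgeDeriv₂ u x) : ℝ) + K * ‖edgeFun u x‖ ^ 2) =
      K * ‖(u : Lp ℂ 2 (volume.restrict s))‖ ^ 2 -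
        (inner ℂ (u : Lp ℂ 2 (volume.restrict s)) (edgeSecondDeriv hs u)).re := by
  rw [re_inner_edgeSecondDeriv, norm_sq_edge, ← integral_const_mul, sub_eq_neg_add,
    ← integral_neg]
  exact integral_add (integrable_inner_edge u u).neg ((integrable_norm_sq_edge u).const_mul _)

theorem le_norm_sq_sub_inner_Icc {a : ℝ} (c : ℝ) (ha : 0 < a)
    (hs : IsNontrivialInterval (Icc 0 a)) (u : edgeDomain (Icc 0 a)) :
    (inner ℝ (edgeFun u 0) (edgeDeriv u 0) : ℝ) + c * ‖edgeFun u 0‖ ^ 2 -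
        (inner ℝ (edgeFun u a) (edgeDeriv u a) : ℝ) + c * ‖edgeFun u a‖ ^ 2 ≤
      (2 * c / a + c ^ 2) * ‖(u : Lp ℂ 2 (volume.restrict (Icc 0 a)))‖ ^ 2 -
        (inner ℂ (u : Lp ℂ 2 (volume.restrict (Icc 0 a))) (edgeSecondDeriv hs u)).re := by
  -- The weight decreases linearly from `c` at `0` to `-c` at `a`.
  have h := (edge_isTwiceAC u).le_integral (c := c) (m := -(2 * c / a)) (K := 2 * c / a + c ^ 2)
    ha.le (fun x hx => by
      have h1 : c + -(2 * c / a) * x = c * (1 - 2 * (x / a)) := by ring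
      have h2 : 0 ≤ x / a := div_nonneg hx.1 ha.le
      have h3 : x / a ≤ 1 := (div_le_one ha).2 hx.2
      have h4 : (1 - 2 * (x / a)) ^ 2 ≤ 1 := by nlinarith
      have := mul_le_mul_of_nonneg_left h4 (sq_nonneg c)
      rw [h1, mul_pow]
      linarith)
  have h5 : c + -(2 * c / a) * a = -c := by field_simp; ring
  rw [h5, intervalIntegral.integral_of_le ha.le, ← integral_Icc_eq_integral_Ioc,
    setIntegral_neg_inner_add hs] at h
  linarith

theorem le_norm_sq_sub_inner_Ici {c : ℝ} (hc : 0 ≤ c)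
    (hs : IsNontrivialInterval (Ici 0)) (u : edgeDomain (Ici (0 : ℝ))) :
    (inner ℝ (edgeFun u 0) (edgeDeriv u 0) : ℝ) + c * ‖edgeFun u 0‖ ^ 2 ≤
      c ^ 2 * ‖(u : Lp ℂ 2 (volume.restrict (Ici (0 : ℝ))))‖ ^ 2 -
        (inner ℂ (u : Lp ℂ 2 (volume.restrict (Ici (0 : ℝ)))) (edgeSecondDeriv hs u)).re := by
  have hint : IntegrableOn (fun x => -(inner ℝ (edgeFun u x) (edgeDeriv₂ u x) : ℝ) +
      c ^ 2 * ‖edgeFun u x‖ ^ 2) (Ici 0) :=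
    (integrable_inner_edge u u).neg.add ((integrable_norm_sq_edge u).const_mul _)
  have hlim := intervalIntegral_tendsto_integral_Ioi 0 (hint.mono_set Ioi_subset_Ici_self)
    Filter.tendsto_id
  rw [← integral_Ici_eq_integral_Ioi, setIntegral_neg_inner_add hs] at hlim
  -- If the claim failed, the boundary term at `X` would eventually exceed a positive number.
  by_contra! hlt
  set L := (inner ℝ (edgeFun u 0) (edgeDeriv u 0) : ℝ) + c * ‖edgeFun u 0‖ ^ 2
  set L' := c ^ 2 * ‖(u : Lp ℂ 2 (volume.restrict (Ici (0 : ℝ))))‖ ^ 2 -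
        (inner ℂ (u : Lp ℂ 2 (volume.restrict (Ici (0 : ℝ)))) (edgeSecondDeriv hs u)).re with hL'
  obtain ⟨X₀, hX₀⟩ := Filter.eventually_atTop.1
    (hlim.eventually_lt_const (show L' < (L + L') / 2 by linarith))
  obtain ⟨X, hX, hX0, hG⟩ := (edge_isTwiceAC u).exists_inner_lt (X₀ := X₀) hc
    (δ := (L - L') / 2) (by linarith) (memLp_edgeFun u)
  have h1 := ((edge_isTwiceAC u).mono (t := Icc 0 X) Icc_subset_Ici_self).le_integral
    (c := c) (m := 0) (K := c ^ 2) hX0 (fun x _ => by simp)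
  have h2 := hX₀ X hX
  simp only [id, zero_mul, add_zero] at h1 h2
  linarith

/-- Green's second identity on the half-line, for `v` vanishing near infinity. -/
theorem green_Ici (hs : IsNontrivialInterval (Ici 0)) {R : ℝ} (hR : 0 ≤ R)
    (u v : edgeDomain (Ici (0 : ℝ))) (hv : ∀ x ≥ R, edgeFun v x = 0) (hv₁ : ∀ x ≥ R, edgeDeriv v x = 0) :
    (inner ℂ (u : Lp ℂ 2 (volume.restrict (Ici (0 : ℝ)))) (edgeSecondDeriv hs v)).re -
        (inner ℂ (v : Lp ℂ 2 (volume.restrict (Ici (0 : ℝ)))) (edgeSecondDeriv hs u)).re =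
      (inner ℝ (edgeDeriv u 0) (edgeFun v 0) : ℝ) - inner ℝ (edgeFun u 0) (edgeDeriv v 0) := by
  have hint := (integrable_inner_edge u v).sub (integrable_inner_edge v u)
  have hlim := intervalIntegral_tendsto_integral_Ioi 0 (hint.mono_set Ioi_subset_Ici_self)
    Filter.tendsto_id
  rw [← integral_Ici_eq_integral_Ioi] at hlim
  rw [re_inner_edgeSecondDeriv, re_inner_edgeSecondDeriv,
    ← integral_sub (integrable_inner_edge u v) (integrable_inner_edge v u)]
  refine tendsto_nhds_unique hlim (tendsto_const_nhds.congr' ?_)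
  filter_upwards [Filter.eventually_ge_atTop R] with X hX
  have h := ((edge_isTwiceAC u).mono (t := Icc 0 X) Icc_subset_Ici_self).green (hR.trans hX)
    ((edge_isTwiceAC v).mono Icc_subset_Ici_self)
  rw [hv X hX, hv₁ X hX, inner_zero_right, inner_zero_right] at h
  simp only [id, Pi.sub_apply]
  simp only [real_inner_comm (edgeDeriv₂ u _)] at h ⊢
  rw [h]
  ring

theorem green_Icc {a : ℝ} (ha : 0 < a) (hs : IsNontrivialInterval (Icc 0 a))
    (u v : edgeDomain (Icc 0 a)) :
    (inner ℂ (u : Lp ℂ 2 (volume.restrict (Icc 0 a))) (edgeSecondDeriv hs v)).re -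
        (inner ℂ (v : Lp ℂ 2 (volume.restrict (Icc 0 a))) (edgeSecondDeriv hs u)).re =
      ((inner ℝ (edgeFun u a) (edgeDeriv v a) : ℝ) - inner ℝ (edgeDeriv u a) (edgeFun v a)) -
        ((inner ℝ (edgeFun u 0) (edgeDeriv v 0) : ℝ) - inner ℝ (edgeDeriv u 0) (edgeFun v 0)) := by
  rw [re_inner_edgeSecondDeriv, re_inner_edgeSecondDeriv,
    ← integral_sub (integrable_inner_edge u v) (integrable_inner_edge v u),
    ← (edge_isTwiceAC u).green ha.le (edge_isTwiceAC v), integral_Icc_eq_integral_Ioc,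
    intervalIntegral.integral_of_le ha.le]
  simp only [real_inner_comm (edgeDeriv₂ u _)]

/-- If `u` and `u''` are bounded by `ε B` and `C / ε` on a set of measure at most `2 ε` and vanish
elsewhere, then `‖u‖` and `⟨u, u''⟩` are of order `ε`. -/
theorem edge_small (hsm : MeasurableSet s) (hs : IsNontrivialInterval s) {u : edgeDomain s}
    {f₂ : ℝ → ℂ} {A : Set ℝ} (hA : MeasurableSet A) {ε B C : ℝ} (hε : 0 < ε) (hB : 0 ≤ B)
    (hC : 0 ≤ C) (hAε : volume A ≤ ENNReal.ofReal (2 * ε))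
    (hu₂ : edgeDeriv₂ u =ᵐ[volume.restrict s] f₂)
    (h0 : ∀ x ∈ s, x ∉ A → edgeFun u x = 0)
    (h1 : ∀ x ∈ s, ‖edgeFun u x‖ ≤ ε * B) (h2 : ∀ x ∈ s, ‖f₂ x‖ ≤ C / ε) :
    ‖(u : Lp ℂ 2 (volume.restrict s))‖ ^ 2 ≤ (ε * B) ^ 2 * (2 * ε) ∧
      |(inner ℂ (u : Lp ℂ 2 (volume.restrict s)) (edgeSecondDeriv hs u)).re| ≤
        B * C * (2 * ε) := by
  have hAs : (volume.restrict s) A ≤ ENNReal.ofReal (2 * ε) :=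
    (Measure.restrict_apply_le s A).trans hAε
  have hfin : (volume.restrict s) A ≠ ∞ := (hAs.trans_lt ENNReal.ofReal_lt_top).ne
  have hreal : (volume.restrict s).real A ≤ 2 * ε :=
    ENNReal.toReal_le_of_le_ofReal (by positivity) hAs
  have key : ∀ (g : ℝ → ℝ) (D : ℝ), 0 ≤ D → (∀ᵐ x ∂volume.restrict s, x ∈ A → ‖g x‖ ≤ D) →
      (∀ᵐ x ∂volume.restrict s, x ∉ A → g x = 0) → |∫ x in s, g x| ≤ D * (2 * ε) := by
    intro g D hD hg hg0
    have hind : Integrable (A.indicator fun _ => D) (volume.restrict s) :=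
      (integrable_indicator_iff hA).2 (integrableOn_const hfin)
    have h := norm_integral_le_of_norm_le (f := g) hind (by
      filter_upwards [hg, hg0] with x hx hx0
      by_cases hxA : x ∈ A
      · rw [indicator_of_mem hxA]; exact hx hxA
      · rw [indicator_of_notMem hxA, hx0 hxA, norm_zero])
    rw [integral_indicator hA, setIntegral_const, smul_eq_mul] at h
    exact h.trans (by rw [mul_comm]; gcongr)
  constructor
  · rw [norm_sq_edge]
    refine (le_abs_self _).trans (key _ _ (by positivity) ?_ ?_)
    · filter_upwards [ae_restrict_mem hsm] with x hx _
      rw [norm_pow, norm_norm]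
      exact pow_le_pow_left₀ (norm_nonneg _) (h1 x hx) 2
    · filter_upwards [ae_restrict_mem hsm] with x hx hxA
      rw [h0 x hx hxA]; simp
  · rw [re_inner_edgeSecondDeriv]
    refine key _ _ (by positivity) ?_ ?_
    · filter_upwards [ae_restrict_mem hsm, hu₂] with x hx hx2 _
      rw [hx2]
      calc ‖(inner ℝ (edgeFun u x) (f₂ x) : ℝ)‖ ≤ ‖edgeFun u x‖ * ‖f₂ x‖ := norm_inner_le_norm _ _
        _ ≤ (ε * B) * (C / ε) := mul_le_mul (h1 x hx) (h2 x hx) (norm_nonneg _) (by positivity)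
        _ = B * C := by field_simp
    · filter_upwards [ae_restrict_mem hsm] with x hx hxA
      rw [h0 x hx hxA, inner_zero_left]

end Edge

/-! ### Elements of the edge domains with prescribed boundary data -/

theorem exists_edge_corner_Ici (hs : IsNontrivialInterval (Ici (0 : ℝ))) (α β : ℂ) {ε : ℝ}
    (hε : 0 < ε) : ∃ u : edgeDomain (Ici (0 : ℝ)),
      EqOn (edgeFun u) (cornerFun α β ε) (Ici 0) ∧
      EqOn (edgeDeriv u) (cornerDeriv α β ε) (Ici 0) ∧
      edgeDeriv₂ u =ᵐ[volume.restrict (Ici 0)] cornerDeriv₂ α β ε := by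
  have hout : ∀ x ∈ Ici (0 : ℝ), x ∉ Icc 0 ε → ε ≤ x := fun x hx hxε =>
    le_of_not_ge fun h => hxε ⟨hx, h⟩
  exact exists_edgeDomain hs
    (.of_hasDerivAt measurableSet_Ici (R := ε) (hasDerivAt_cornerFun α β)
      (hasDerivAt_cornerDeriv α β) (continuous_cornerDeriv₂ α β)
      fun x hx hxε => cornerDeriv₂_eq_zero α β hε (hout x hx hxε))
    (memLp_of_continuous_of_eq_zero measurableSet_Ici (R := ε)
      (continuous_iff_continuousAt.2 fun x => (hasDerivAt_cornerFun α β x).continuousAt)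
      fun x hx hxε => cornerFun_eq_zero α β hε (hout x hx hxε))

theorem exists_edge_corner_Icc {a : ℝ} (hs : IsNontrivialInterval (Icc 0 a)) (α β α' β' : ℂ)
    (ε : ℝ) : ∃ u : edgeDomain (Icc 0 a),
      EqOn (edgeFun u) (fun x => cornerFun α β ε x + cornerFun α' β' ε (a - x)) (Icc 0 a) ∧
      EqOn (edgeDeriv u) (fun x => cornerDeriv α β ε x - cornerDeriv α' β' ε (a - x)) (Icc 0 a) ∧
      edgeDeriv₂ u =ᵐ[volume.restrict (Icc 0 a)]
        fun x => cornerDeriv₂ α β ε x + cornerDeriv₂ α' β' ε (a - x) := by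
  have hd : ∀ x, HasDerivAt (fun x => cornerFun α β ε x + cornerFun α' β' ε (a - x))
      (cornerDeriv α β ε x - cornerDeriv α' β' ε (a - x)) x := fun x =>
    ((hasDerivAt_cornerFun α β x).add
      ((hasDerivAt_cornerFun α' β' (a - x)).comp_const_sub a x)).congr_deriv (by ring)
  have hd₁ : ∀ x, HasDerivAt (fun x => cornerDeriv α β ε x - cornerDeriv α' β' ε (a - x))
      (cornerDeriv₂ α β ε x + cornerDeriv₂ α' β' ε (a - x)) x := fun x =>
    ((hasDerivAt_cornerDeriv α β x).sub
      ((hasDerivAt_cornerDeriv α' β' (a - x)).comp_const_sub a x)).congr_deriv (by ring)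
  exact exists_edgeDomain hs
    (.of_hasDerivAt measurableSet_Icc (R := a) hd hd₁
      ((continuous_cornerDeriv₂ α β).add
        ((continuous_cornerDeriv₂ α' β').comp (continuous_const.sub continuous_id)))
      fun x hx hxa => absurd hx hxa)
    (memLp_of_continuous_of_eq_zero measurableSet_Icc (R := a)
      (continuous_iff_continuousAt.2 fun x => (hd x).continuousAt)
      fun x hx hxa => absurd hx hxa)

theorem exists_edge_data_Ici (hs : IsNontrivialInterval (Ici (0 : ℝ))) (α β : ℂ) :
    ∃ u : edgeDomain (Ici (0 : ℝ)), edgeFun u 0 = α ∧ edgeDeriv u 0 = β := by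
  obtain ⟨u, h0, h1, -⟩ := exists_edge_corner_Ici hs α β one_pos
  exact ⟨u, by rw [h0 self_mem_Ici, cornerFun_zero], by rw [h1 self_mem_Ici, cornerDeriv_zero]⟩

theorem edge_data_of_corner_Icc {a ε : ℝ} (hε : 0 < ε) (hεa : ε ≤ a) {α β α' β' : ℂ}
    {u : edgeDomain (Icc 0 a)}
    (h0 : EqOn (edgeFun u) (fun x => cornerFun α β ε x + cornerFun α' β' ε (a - x)) (Icc 0 a))
    (h1 : EqOn (edgeDeriv u) (fun x => cornerDeriv α β ε x - cornerDeriv α' β' ε (a - x))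
      (Icc 0 a)) :
    edgeFun u 0 = α ∧ edgeDeriv u 0 = β ∧ edgeFun u a = α' ∧ -edgeDeriv u a = β' := by
  have ha : 0 ≤ a := hε.le.trans hεa
  simp [h0 (left_mem_Icc.2 ha), h1 (left_mem_Icc.2 ha), h0 (right_mem_Icc.2 ha),
    h1 (right_mem_Icc.2 ha), cornerFun_zero, cornerDeriv_zero, cornerFun_eq_zero _ _ hε hεa,
    cornerDeriv_eq_zero _ _ hε hεa]

theorem exists_edge_data_Icc {a : ℝ} (ha : 0 < a) (hs : IsNontrivialInterval (Icc 0 a))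
    (α β α' β' : ℂ) : ∃ u : edgeDomain (Icc 0 a),
      edgeFun u 0 = α ∧ edgeDeriv u 0 = β ∧ edgeFun u a = α' ∧ -edgeDeriv u a = β' := by
  obtain ⟨u, h0, h1, -⟩ := exists_edge_corner_Icc hs α β α' β' a
  exact ⟨u, edge_data_of_corner_Icc ha le_rfl h0 h1⟩

theorem exists_small_scale {a δ : ℝ} (B : ℝ) (ha : 0 < a) (hδ : 0 < δ) :
    ∃ ε > 0, ε ≤ a ∧ (ε * B) ^ 2 * (2 * ε) ≤ δ ∧ B * (12 * B) * (2 * ε) ≤ δ := by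
  have hpos : 0 < δ / (24 * B ^ 2 + 1) := by positivity
  refine ⟨min a (min 1 (δ / (24 * B ^ 2 + 1))), by positivity, min_le_left _ _, ?_⟩
  set ε := min a (min 1 (δ / (24 * B ^ 2 + 1)))
  have hε : 0 < ε := by positivity
  have h1 : ε ≤ 1 := (min_le_right _ _).trans (min_le_left _ _)
  have h2 : ε * (24 * B ^ 2 + 1) ≤ δ :=
    (le_div_iff₀ (by positivity)).1 ((min_le_right _ _).trans (min_le_right _ _))
  have h3 : B * (12 * B) * (2 * ε) ≤ δ := by nlinarith
  refine ⟨?_, h3⟩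
  calc (ε * B) ^ 2 * (2 * ε) = ε ^ 2 * (2 * B ^ 2 * ε) := by ring
    _ ≤ 1 * (2 * B ^ 2 * ε) := by gcongr; exact pow_le_one₀ hε.le h1
    _ ≤ B * (12 * B) * (2 * ε) := by nlinarith [mul_nonneg (sq_nonneg B) hε.le]
    _ ≤ δ := h3

/-- On the half-line, a boundary slope `β` with boundary value `0` can be realised at an arbitrarily
small cost in `‖u‖` and `⟨u, u''⟩`. -/
theorem exists_edge_small_Ici (hs : IsNontrivialInterval (Ici (0 : ℝ))) (β : ℂ) {δ : ℝ}
    (hδ : 0 < δ) : ∃ u : edgeDomain (Ici (0 : ℝ)), edgeFun u 0 = 0 ∧ edgeDeriv u 0 = β ∧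
      ‖(u : Lp ℂ 2 (volume.restrict (Ici (0 : ℝ))))‖ ^ 2 ≤ δ ∧
      |(inner ℂ (u : Lp ℂ 2 (volume.restrict (Ici (0 : ℝ)))) (edgeSecondDeriv hs u)).re| ≤ δ ∧
      ∀ w : edgeDomain (Ici (0 : ℝ)),
        (inner ℂ (w : Lp ℂ 2 (volume.restrict (Ici (0 : ℝ)))) (edgeSecondDeriv hs u)).re -
          (inner ℂ (u : Lp ℂ 2 (volume.restrict (Ici (0 : ℝ)))) (edgeSecondDeriv hs w)).re =
        -(inner ℝ (edgeFun w 0) β : ℝ) := by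
  obtain ⟨ε, hε, -, h1, h2⟩ := exists_small_scale ‖β‖ one_pos hδ
  obtain ⟨u, hu0, hu1, hu2⟩ := exists_edge_corner_Ici hs 0 β hε
  have e0 : edgeFun u 0 = 0 := by rw [hu0 self_mem_Ici, cornerFun_zero]
  have e1 : edgeDeriv u 0 = β := by rw [hu1 self_mem_Ici, cornerDeriv_zero]
  have hsmall := edge_small measurableSet_Ici hs measurableSet_Icc (A := Icc 0 ε) hε
    (norm_nonneg β) (C := 12 * ‖β‖) (by positivity)
    (by rw [Real.volume_Icc]; exact ENNReal.ofReal_le_ofReal (by linarith)) hu2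
    (fun x hx hxε => by
      rw [hu0 hx, cornerFun_eq_zero _ _ hε (le_of_not_ge fun h => hxε ⟨hx, h⟩)])
    (fun x hx => by rw [hu0 hx]; exact norm_cornerFun_le β hε hx)
    (fun x hx => norm_cornerDeriv₂_le β hε hx)
  refine ⟨u, e0, e1, hsmall.1.trans h1, hsmall.2.trans h2, fun w => ?_⟩
  rw [green_Ici hs hε.le w u (fun x hx => ?_) (fun x hx => ?_), e0, e1, inner_zero_right, zero_sub]
  · rw [hu0 (hε.le.trans hx), cornerFun_eq_zero _ _ hε hx]
  · rw [hu1 (hε.le.trans hx), cornerDeriv_eq_zero _ _ hε hx]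

/-- The analogue of `exists_edge_small_Ici` on `[0, a]`, with inward slopes at both ends. -/
theorem exists_edge_small_Icc {a : ℝ} (ha : 0 < a) (hs : IsNontrivialInterval (Icc 0 a))
    (β β' : ℂ) {δ : ℝ} (hδ : 0 < δ) : ∃ u : edgeDomain (Icc 0 a),
      (edgeFun u 0 = 0 ∧ edgeDeriv u 0 = β ∧ edgeFun u a = 0 ∧ -edgeDeriv u a = β') ∧
      ‖(u : Lp ℂ 2 (volume.restrict (Icc 0 a)))‖ ^ 2 ≤ δ ∧
      |(inner ℂ (u : Lp ℂ 2 (volume.restrict (Icc 0 a))) (edgeSecondDeriv hs u)).re| ≤ δ ∧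
      ∀ w : edgeDomain (Icc 0 a),
        (inner ℂ (w : Lp ℂ 2 (volume.restrict (Icc 0 a))) (edgeSecondDeriv hs u)).re -
          (inner ℂ (u : Lp ℂ 2 (volume.restrict (Icc 0 a))) (edgeSecondDeriv hs w)).re =
        -((inner ℝ (edgeFun w 0) β : ℝ) + inner ℝ (edgeFun w a) β') := by
  obtain ⟨ε, hε, hεa, h1, h2⟩ := exists_small_scale (‖β‖ + ‖β'‖) ha hδ
  obtain ⟨u, hu0, hu1, hu2⟩ := exists_edge_corner_Icc hs 0 β 0 β' ε
  have hdata := edge_data_of_corner_Icc hε hεa hu0 hu1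
  have hsmall := edge_small measurableSet_Icc hs (measurableSet_Icc.union measurableSet_Icc)
    (A := Icc 0 ε ∪ Icc (a - ε) a) hε (add_nonneg (norm_nonneg β) (norm_nonneg β'))
    (C := 12 * (‖β‖ + ‖β'‖)) (by positivity)
    (by
      refine (measure_union_le _ _).trans ?_
      rw [Real.volume_Icc, Real.volume_Icc, ← ENNReal.ofReal_add (by linarith) (by linarith)]
      exact ENNReal.ofReal_le_ofReal (by linarith)) hu2
    (fun x hx hxA => by
      have h3 : ε ≤ x := le_of_not_ge fun h => hxA (Or.inl ⟨hx.1, h⟩)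
      have h4 : ε ≤ a - x := le_of_not_ge fun h => hxA (Or.inr ⟨by linarith, hx.2⟩)
      rw [hu0 hx]
      simp only [cornerFun_eq_zero _ _ hε h3, cornerFun_eq_zero _ _ hε h4, add_zero])
    (fun x hx => by
      rw [hu0 hx, mul_add]
      exact norm_add_le_of_le (norm_cornerFun_le β hε hx.1)
        (norm_cornerFun_le β' hε (sub_nonneg.2 hx.2)))
    (fun x hx => by
      rw [mul_add, add_div]
      exact norm_add_le_of_le (norm_cornerDeriv₂_le β hε hx.1)
        (norm_cornerDeriv₂_le β' hε (sub_nonneg.2 hx.2)))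
  refine ⟨u, hdata, hsmall.1.trans h1, hsmall.2.trans h2, fun w => ?_⟩
  obtain ⟨e1, e2, e3, e4⟩ := hdata
  rw [green_Icc ha hs w u, e1, e2, e3, neg_eq_iff_eq_neg.1 e4]
  simp only [inner_zero_right, inner_neg_right]
  ring

namespace MetricGraph

variable {V I E : Type*} (G : MetricGraph V I E)

/-! ### The operator on the graph -/

/-- The maximal operator `Δ` as a linear map on its domain. -/
noncomputable def maxOp : G.maxDomain →ₗ[ℂ] G.Space := G.laplacian.toFun

/-- The element of the maximal domain with given components on the edges. -/
noncomputable def ofEdges (u : ∀ j : E ⊕ I, edgeDomain (G.interval j)) : G.maxDomain :=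
  ⟨WithLp.toLp 2 fun j => (u j : Lp ℂ 2 (volume.restrict (G.interval j))), fun j => (u j).2⟩

theorem bdryMap_eq_iff (ψ : G.maxDomain) (χ : G.BdrySpace × G.BdrySpace) :
    G.bdryMap ψ = χ ↔
      (∀ e, edgeFun (G.onEdge (Sum.inl e) ψ) 0 = χ.1 (Sum.inl e) ∧
        edgeDeriv (G.onEdge (Sum.inl e) ψ) 0 = χ.2 (Sum.inl e)) ∧
      ∀ i, edgeFun (G.onEdge (Sum.inr i) ψ) 0 = χ.1 (Sum.inr (Sum.inl i)) ∧
        edgeDeriv (G.onEdge (Sum.inr i) ψ) 0 = χ.2 (Sum.inr (Sum.inl i)) ∧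
        edgeFun (G.onEdge (Sum.inr i) ψ) (G.length i) = χ.1 (Sum.inr (Sum.inr i)) ∧
        -edgeDeriv (G.onEdge (Sum.inr i) ψ) (G.length i) = χ.2 (Sum.inr (Sum.inr i)) := by
  constructor
  · rintro rfl
    exact ⟨fun e => ⟨rfl, rfl⟩, fun i => ⟨rfl, rfl, rfl, rfl⟩⟩
  · rintro ⟨h1, h2⟩
    refine Prod.ext ?_ ?_
    · ext k
      rcases k with e | i | i
      · exact (h1 e).1
      · exact (h2 i).1
      · exact (h2 i).2.2.1
    · ext k
      rcases k with e | i | i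
      · exact (h1 e).2
      · exact (h2 i).2.1
      · exact (h2 i).2.2.2

theorem bdryMap_surjective : Function.Surjective G.bdryMap := by
  intro χ
  choose u hu using fun e : E => exists_edge_data_Ici (G.isNontrivialInterval (Sum.inl e))
    (χ.1 (Sum.inl e)) (χ.2 (Sum.inl e))
  choose v hv using fun i : I => exists_edge_data_Icc (G.length_pos i)
    (G.isNontrivialInterval (Sum.inr i)) (χ.1 (Sum.inr (Sum.inl i))) (χ.2 (Sum.inr (Sum.inl i)))
    (χ.1 (Sum.inr (Sum.inr i))) (χ.2 (Sum.inr (Sum.inr i)))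
  exact ⟨G.ofEdges fun j => match j with
    | Sum.inl e => u e
    | Sum.inr i => v i, (G.bdryMap_eq_iff _ _).2 ⟨hu, hv⟩⟩

theorem mem_minDomain_iff (ψ : G.maxDomain) : (ψ : G.Space) ∈ G.minDomain ↔ G.bdryMap ψ = 0 := by
  rw [bdryMap_eq_iff]
  constructor
  · rintro ⟨φ, ⟨h1, h2⟩, h⟩
    obtain rfl : φ = ψ := Subtype.ext h
    exact ⟨h1, fun i => ⟨(h2 i).1, (h2 i).2.1, (h2 i).2.2.1, neg_eq_zero.2 (h2 i).2.2.2⟩⟩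
  · rintro ⟨h1, h2⟩
    exact ⟨ψ, ⟨h1, fun i => ⟨(h2 i).1, (h2 i).2.1, (h2 i).2.2.1, neg_eq_zero.1 (h2 i).2.2.2⟩⟩, rfl⟩

variable [Fintype I] [Fintype E]

theorem re_inner_maxOp (φ ψ : G.maxDomain) :
    (inner ℂ (φ : G.Space) (G.maxOp ψ)).re =
      ∑ j, (inner ℂ (G.onEdge j φ : Lp ℂ 2 (volume.restrict (G.interval j)))
        (edgeSecondDeriv (G.isNontrivialInterval j) (G.onEdge j ψ))).re := by
  rw [PiLp.inner_apply, Complex.re_sum]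
  rfl

theorem norm_sq_eq_sum (φ : G.maxDomain) :
    ‖(φ : G.Space)‖ ^ 2 =
      ∑ j, ‖(G.onEdge j φ : Lp ℂ 2 (volume.restrict (G.interval j)))‖ ^ 2 :=
  PiLp.norm_sq_eq_of_L2 _ _

theorem re_inner_bdrySpace (χ η : G.BdrySpace) :
    (inner ℂ χ η).re = ∑ e, (inner ℝ (χ (Sum.inl e)) (η (Sum.inl e)) : ℝ) +
      ∑ i, ((inner ℝ (χ (Sum.inr (Sum.inl i))) (η (Sum.inr (Sum.inl i))) : ℝ) +
        inner ℝ (χ (Sum.inr (Sum.inr i))) (η (Sum.inr (Sum.inr i)))) := by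
  rw [PiLp.inner_apply, Complex.re_sum, Fintype.sum_sum_type, Fintype.sum_sum_type,
    ← Finset.sum_add_distrib]
  rfl

/-- Boundary data `(0, η)` can be realised at an arbitrarily small cost in `‖ψ‖` and `⟨ψ, Δψ⟩`. -/
theorem exists_small (η : G.BdrySpace) {δ : ℝ} (hδ : 0 < δ) :
    ∃ ψ : G.maxDomain, G.bdryMap ψ = (0, η) ∧ ‖(ψ : G.Space)‖ ^ 2 ≤ δ ∧
      |(inner ℂ (ψ : G.Space) (G.maxOp ψ)).re| ≤ δ ∧
      ∀ φ : G.maxDomain, (inner ℂ (φ : G.Space) (G.maxOp ψ)).re -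
        (inner ℂ (ψ : G.Space) (G.maxOp φ)).re = -(inner ℂ (G.bdryValue φ) η).re := by
  set n : ℝ := (Fintype.card (E ⊕ I) : ℝ) with hn
  have hδ' : 0 < δ / (n + 1) := by positivity
  have hsum : ∑ _j : E ⊕ I, δ / (n + 1) ≤ δ := by
    rw [Finset.sum_const, Finset.card_univ, nsmul_eq_mul, ← hn, mul_div_assoc', div_le_iff₀]
    · nlinarith
    · positivity
  choose u hu0 hu1 hu2 hu3 hu4 using fun e : E => exists_edge_small_Ici
    (G.isNontrivialInterval (Sum.inl e)) (η (Sum.inl e)) hδ'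
  choose v hv1 hv2 hv3 hv4 using fun i : I => exists_edge_small_Icc (G.length_pos i)
    (G.isNontrivialInterval (Sum.inr i)) (η (Sum.inr (Sum.inl i))) (η (Sum.inr (Sum.inr i))) hδ'
  set ψ : G.maxDomain := G.ofEdges fun j => match j with
    | Sum.inl e => u e
    | Sum.inr i => v i
  refine ⟨ψ, (G.bdryMap_eq_iff _ _).2 ⟨fun e => ⟨hu0 e, hu1 e⟩, hv1⟩, ?_, ?_, fun φ => ?_⟩
  · rw [norm_sq_eq_sum]
    refine (Finset.sum_le_sum fun j _ => ?_).trans hsum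
    rcases j with e | i
    · exact hu2 e
    · exact hv2 i
  · rw [re_inner_maxOp]
    refine (Finset.abs_sum_le_sum_abs _ _).trans ((Finset.sum_le_sum fun j _ => ?_).trans hsum)
    rcases j with e | i
    · exact hu3 e
    · exact hv3 i
  · rw [re_inner_maxOp, re_inner_maxOp, ← Finset.sum_sub_distrib, re_inner_bdrySpace,
      Fintype.sum_sum_type, neg_add, ← Finset.sum_neg_distrib, ← Finset.sum_neg_distrib]
    refine congrArg₂ _ (Finset.sum_congr rfl fun e _ => ?_) (Finset.sum_congr rfl fun i _ => ?_)
    · exact hu4 e (G.onEdge (Sum.inl e) φ)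
    · exact hv4 i (G.onEdge (Sum.inr i) φ)

/-- The trace inequality: the quadratic form of `-Δ` controls the boundary values with an
arbitrarily large factor, up to a multiple of `‖ψ‖²`. -/
theorem exists_le_norm_sq_sub_inner {c : ℝ} (hc : 0 ≤ c) : ∃ K : ℝ, ∀ ψ : G.maxDomain,
    (inner ℂ (G.bdryValue ψ) (G.bdryDeriv ψ)).re + c * ‖G.bdryValue ψ‖ ^ 2 ≤
      K * ‖(ψ : G.Space)‖ ^ 2 - (inner ℂ (ψ : G.Space) (G.maxOp ψ)).re := by
  set L := ∑ i, 2 * c / G.length i with hL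
  have hLi : ∀ i, 2 * c / G.length i ≤ L := fun i =>
    Finset.single_le_sum (f := fun i => 2 * c / G.length i)
      (fun k _ => div_nonneg (by positivity) (G.length_pos k).le) (Finset.mem_univ i)
  have hL0 : 0 ≤ L := Finset.sum_nonneg fun k _ => div_nonneg (by positivity) (G.length_pos k).le
  refine ⟨L + c ^ 2, fun ψ => ?_⟩
  rw [re_inner_maxOp, norm_sq_eq_sum, Finset.mul_sum, ← Finset.sum_sub_distrib,
    re_inner_bdrySpace, ← inner_self_eq_norm_sq (𝕜 := ℂ) (G.bdryValue ψ), RCLike.re_eq_complex_re,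
    re_inner_bdrySpace, Fintype.sum_sum_type, mul_add, Finset.mul_sum, Finset.mul_sum,
    add_add_add_comm, ← Finset.sum_add_distrib, ← Finset.sum_add_distrib]
  refine add_le_add (Finset.sum_le_sum fun e _ => ?_) (Finset.sum_le_sum fun i _ => ?_)
  · have h := le_norm_sq_sub_inner_Ici hc (G.isNontrivialInterval (Sum.inl e))
      (G.onEdge (Sum.inl e) ψ)
    rw [real_inner_self_eq_norm_sq]
    refine h.trans (sub_le_sub_right (mul_le_mul_of_nonneg_right ?_ (sq_nonneg _)) _)
    linarith
  · have h := le_norm_sq_sub_inner_Icc c (G.length_pos i) (G.isNontrivialInterval (Sum.inr i))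
      (G.onEdge (Sum.inr i) ψ)
    rw [real_inner_self_eq_norm_sq, real_inner_self_eq_norm_sq]
    have h2 : (inner ℝ (G.bdryValue ψ (Sum.inr (Sum.inr i)))
        (G.bdryDeriv ψ (Sum.inr (Sum.inr i))) : ℝ) =
        -(inner ℝ (edgeFun (G.onEdge (Sum.inr i) ψ) (G.length i))
          (edgeDeriv (G.onEdge (Sum.inr i) ψ) (G.length i)) : ℝ) := inner_neg_right _ _
    rw [h2]
    refine le_trans (le_of_eq ?_) (h.trans (sub_le_sub_right
      (mul_le_mul_of_nonneg_right (add_le_add_left (hLi i) _) (sq_nonneg _)) _))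
    exact (by intros; ring : ∀ p q x y : ℝ, p + -q + c * (x + y) = p + c * x - q + c * y) _ _ _ _

end MetricGraph

/-! ### Linear relations -/

section Relation

variable {K : Type*} [NormedAddCommGroup K] [InnerProductSpace ℂ K] [FiniteDimensional ℂ K]

/-- If the multivalued part of a linear relation `M` is orthogonal to its domain, then
`Re ⟨χ₁, χ₂⟩` is bounded below by a multiple of `‖χ₁‖²` on `M`: modulo the multivalued part, `χ₂`
is a linear function of `χ₁`. -/
theorem exists_neg_le_re_inner (M : Submodule ℂ (K × K))
    (h : ∀ χ ∈ M, ∀ η, (0, η) ∈ M → inner ℂ χ.1 η = 0) :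
    ∃ c : ℝ, 0 ≤ c ∧ ∀ χ ∈ M, -(c * ‖χ.1‖ ^ 2) ≤ (inner ℂ χ.1 χ.2).re := by
  set p : M →ₗ[ℂ] K := LinearMap.fst ℂ K K ∘ₗ M.subtype
  obtain ⟨g, hg⟩ := p.rangeRestrict.exists_rightInverse_of_surjective p.range_rangeRestrict
  set L : LinearMap.range p →L[ℂ] K :=
    LinearMap.toContinuousLinearMap (LinearMap.snd ℂ K K ∘ₗ M.subtype ∘ₗ g)
  refine ⟨‖L‖, norm_nonneg L, fun χ hχ => ?_⟩
  set y := p.rangeRestrict ⟨χ, hχ⟩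
  have hy : (g y : K × K).1 = χ.1 := congrArg Subtype.val (LinearMap.congr_fun hg y)
  have hmem : ((0 : K), χ.2 - L y) ∈ M := by
    have := M.sub_mem hχ (g y).2
    rwa [show χ - (g y : K × K) = (0, χ.2 - L y) from
      Prod.ext (sub_eq_zero.2 hy.symm) rfl] at this
  have h1 : inner ℂ χ.1 χ.2 = inner ℂ χ.1 (L y) := by
    have := h χ hχ _ hmem
    rwa [inner_sub_right, sub_eq_zero] at this
  have h2 : ‖inner ℂ χ.1 (L y)‖ ≤ ‖L‖ * ‖χ.1‖ ^ 2 :=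
    calc ‖inner ℂ χ.1 (L y)‖ ≤ ‖χ.1‖ * ‖L y‖ := norm_inner_le_norm _ _
      _ ≤ ‖χ.1‖ * (‖L‖ * ‖χ.1‖) := by gcongr; exact L.le_opNorm y
      _ = ‖L‖ * ‖χ.1‖ ^ 2 := by ring
  rw [h1]
  exact neg_le_of_abs_le ((Complex.abs_re_le_norm _).trans h2)

/-- If the multivalued part of a linear relation is the orthogonal complement of its domain, then
the relation has half the dimension of `K × K`. -/
theorem finrank_eq_of_multivalued_eq_orthogonal (M : Submodule ℂ (K × K))
    (h : ∀ η, (0, η) ∈ M ↔ η ∈ (M.map (LinearMap.fst ℂ K K))ᗮ) :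
    Module.finrank ℂ M = Module.finrank ℂ K := by
  set P := M.map (LinearMap.fst ℂ K K) with hP
  have hrange : LinearMap.range (LinearMap.fst ℂ K K ∘ₗ M.subtype) = P := by
    rw [LinearMap.range_comp, Submodule.range_subtype]
  have hker : Pᗮ.map (LinearMap.inr ℂ K K) =
      (LinearMap.ker (LinearMap.fst ℂ K K ∘ₗ M.subtype)).map M.subtype := by
    ext ⟨a, b⟩
    constructor
    · rintro ⟨η, hη, he⟩
      rw [← he]
      exact ⟨⟨(0, η), (h η).2 hη⟩, rfl, rfl⟩
    · rintro ⟨⟨χ, hχ⟩, hx, he⟩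
      have h0 : a = 0 := by
        have h1 : χ.1 = 0 := hx
        rw [← h1, show χ = (a, b) from he]
      subst h0
      have h2 : χ = (0, b) := he
      exact ⟨b, (h b).1 (h2 ▸ hχ), rfl⟩
  have h1 := LinearMap.finrank_range_add_finrank_ker (LinearMap.fst ℂ K K ∘ₗ M.subtype)
  rw [hrange, ← Submodule.finrank_map_subtype_eq, ← hker,
    ← (Submodule.equivMapOfInjective _ LinearMap.inr_injective Pᗮ).finrank_eq,
    Submodule.finrank_add_finrank_orthogonal] at h1
  exact h1.symm

/-- A subspace of `K × K` of half the dimension is the kernel of a surjective map `(A, B)`. -/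
theorem exists_coprod_ker_eq (M : Submodule ℂ (K × K))
    (h : Module.finrank ℂ M = Module.finrank ℂ K) :
    ∃ A B : K →ₗ[ℂ] K, Function.Surjective (A.coprod B) ∧ LinearMap.ker (A.coprod B) = M := by
  have h1 : Module.finrank ℂ ((K × K) ⧸ M) = Module.finrank ℂ K := by
    have := M.finrank_quotient_add_finrank
    rw [Module.finrank_prod] at this
    omega
  set e := LinearEquiv.ofFinrankEq _ _ h1
  set C : K × K →ₗ[ℂ] K := e.toLinearMap ∘ₗ M.mkQ
  refine ⟨C ∘ₗ LinearMap.inl ℂ K K, C ∘ₗ LinearMap.inr ℂ K K, ?_, ?_⟩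
  · rw [← LinearMap.comp_coprod, LinearMap.coprod_inl_inr, LinearMap.comp_id]
    exact e.surjective.comp M.mkQ_surjective
  · rw [← LinearMap.comp_coprod, LinearMap.coprod_inl_inr, LinearMap.comp_id, LinearEquiv.ker_comp,
      Submodule.ker_mkQ]

end Relation

theorem LinearPMap.le_of_le_of_domain_le {R F H : Type*} [Ring R] [AddCommGroup F] [Module R F]
    [AddCommGroup H] [Module R H] {f g h : F →ₗ.[R] H} (hf : f ≤ h) (hg : g ≤ h)
    (hd : f.domain ≤ g.domain) : f ≤ g :=
  ⟨hd, fun x _ hxy => (hf.2 (y := ⟨x, hf.1 x.2⟩) rfl).trans (hg.2 hxy.symm).symm⟩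

theorem Complex.eq_zero_of_forall_nonneg_add_re_mul {a : ℝ} {w : ℂ}
    (h : ∀ z : ℂ, 0 ≤ a + (z * w).re) : w = 0 := by
  by_contra hw
  have hpos : 0 < Complex.normSq w := Complex.normSq_pos.2 hw
  -- The choice `z = -t * conj w` gives `a ≥ t |w|²`, which fails for `t = (|a| + 1) / |w|²`.
  have h1 := h (-(((|a| + 1) / Complex.normSq w : ℝ) : ℂ) * (starRingEnd ℂ) w)
  rw [mul_assoc, ← Complex.normSq_eq_conj_mul_self, ← Complex.ofReal_neg, ← Complex.ofReal_mul,
    Complex.ofReal_re, neg_mul, div_mul_cancel₀ _ hpos.ne'] at h1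
  linarith [le_abs_self a]

namespace MetricGraph

variable {V I E : Type*} (G : MetricGraph V I E)

/-! ### Restrictions of the maximal operator -/

theorem bdryMap_fst (ψ : G.maxDomain) : (G.bdryMap ψ).1 = G.bdryValue ψ := rfl

theorem bdryMap_snd (ψ : G.maxDomain) : (G.bdryMap ψ).2 = G.bdryDeriv ψ := rfl

theorem mem_negLaplacianOn_domain {M : Submodule ℂ (G.BdrySpace × G.BdrySpace)} (ψ : G.maxDomain) :
    (ψ : G.Space) ∈ (G.negLaplacianOn M).domain ↔ G.bdryMap ψ ∈ M := by
  constructor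
  · rintro ⟨⟨φ, hφ, h⟩, -⟩
    obtain rfl : φ = ψ := Subtype.ext h
    exact hφ
  · exact fun h => ⟨⟨ψ, h, rfl⟩, ψ.2⟩

theorem negLaplacianOn_domain_le (M : Submodule ℂ (G.BdrySpace × G.BdrySpace)) :
    (G.negLaplacianOn M).domain ≤ G.maxDomain := fun _ h => h.2

theorem minDomain_le_maxDomain : G.minDomain ≤ G.maxDomain := Submodule.map_subtype_le _ _

theorem negLaplacianOn_le (M : Submodule ℂ (G.BdrySpace × G.BdrySpace)) :
    G.negLaplacianOn M ≤ -G.laplacian := LinearPMap.domRestrict_le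

theorem negLaplacianOn_apply {M : Submodule ℂ (G.BdrySpace × G.BdrySpace)} (ψ : G.maxDomain)
    (hψ : (ψ : G.Space) ∈ (G.negLaplacianOn M).domain) :
    G.negLaplacianOn M ⟨ψ, hψ⟩ = -G.maxOp ψ :=
  (G.negLaplacianOn_le M).2 (y := ψ) rfl

/-- An operator between `-Δ⁰` and `-Δ` is determined by the boundary data of its domain. -/
theorem eq_negLaplacianOn {T : G.Space →ₗ.[ℂ] G.Space} (hmin : -G.minLaplacian ≤ T)
    (hmax : T ≤ -G.laplacian) :
    T = G.negLaplacianOn ((T.domain.comap G.maxDomain.subtype).map G.bdryMap) := by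
  have hmin' : G.minDomain ≤ T.domain := fun ψ hψ =>
    hmin.1 (show ψ ∈ G.minDomain ⊓ G.maxDomain from ⟨hψ, G.minDomain_le_maxDomain hψ⟩)
  have hmax' : T.domain ≤ G.maxDomain := hmax.1
  have hdom : T.domain =
      (G.negLaplacianOn ((T.domain.comap G.maxDomain.subtype).map G.bdryMap)).domain := by
    ext u
    constructor
    · intro hu
      exact (G.mem_negLaplacianOn_domain ⟨u, hmax' hu⟩).2 ⟨⟨u, hmax' hu⟩, hu, rfl⟩
    · intro hu
      have hu' : u ∈ G.maxDomain := G.negLaplacianOn_domain_le _ hu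
      obtain ⟨φ, hφ, he⟩ := (G.mem_negLaplacianOn_domain ⟨u, hu'⟩).1 hu
      have hsub : (((⟨u, hu'⟩ - φ : G.maxDomain)) : G.Space) ∈ G.minDomain := by
        rw [mem_minDomain_iff, map_sub, he, sub_self]
      exact (T.domain.sub_mem_iff_left hφ).1 (hmin' hsub)
  exact le_antisymm (LinearPMap.le_of_le_of_domain_le hmax (G.negLaplacianOn_le _) hdom.le)
    (LinearPMap.le_of_le_of_domain_le (G.negLaplacianOn_le _) hmax hdom.ge)

theorem negLaplacianOn_mono {M N : Submodule ℂ (G.BdrySpace × G.BdrySpace)} (h : M ≤ N) :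
    G.negLaplacianOn M ≤ G.negLaplacianOn N := by
  refine LinearPMap.le_of_le_of_domain_le (G.negLaplacianOn_le M) (G.negLaplacianOn_le N)
    fun u hu => ?_
  have hu' := G.negLaplacianOn_domain_le _ hu
  exact (G.mem_negLaplacianOn_domain ⟨u, hu'⟩).2 (h ((G.mem_negLaplacianOn_domain ⟨u, hu'⟩).1 hu))

theorem negLaplacianOn_injective : Function.Injective G.negLaplacianOn := by
  intro M N h
  ext χ
  obtain ⟨ψ, rfl⟩ := G.bdryMap_surjective χ
  rw [← mem_negLaplacianOn_domain, h, mem_negLaplacianOn_domain]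

variable [Fintype I] [Fintype E]

/-- Quasi-accretivity of `-Δ(M)` as a condition on functions in the maximal domain. -/
theorem isQuasiAccretive_negLaplacianOn_iff {M : Submodule ℂ (G.BdrySpace × G.BdrySpace)} :
    IsQuasiAccretive (G.negLaplacianOn M) ↔ ∃ C : ℝ, ∀ ψ : G.maxDomain, G.bdryMap ψ ∈ M →
      0 ≤ -(inner ℂ (ψ : G.Space) (G.maxOp ψ)).re + C * ‖(ψ : G.Space)‖ ^ 2 := by
  have key : ∀ (C : ℝ) (ψ : G.maxDomain) (hψ : (ψ : G.Space) ∈ (G.negLaplacianOn M).domain),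
      (inner ℂ (ψ : G.Space) (G.negLaplacianOn M ⟨ψ, hψ⟩)).re +
        C * (inner ℂ (ψ : G.Space) (ψ : G.Space)).re =
      -(inner ℂ (ψ : G.Space) (G.maxOp ψ)).re + C * ‖(ψ : G.Space)‖ ^ 2 := by
    intro C ψ hψ
    rw [G.negLaplacianOn_apply ψ hψ, inner_neg_right, Complex.neg_re,
      ← inner_self_eq_norm_sq (𝕜 := ℂ) (ψ : G.Space), RCLike.re_eq_complex_re]
  constructor
  · rintro ⟨C, hC⟩
    refine ⟨C, fun ψ hψ => ?_⟩
    rw [← key C ψ ((G.mem_negLaplacianOn_domain ψ).2 hψ)]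
    exact hC ⟨ψ, (G.mem_negLaplacianOn_domain ψ).2 hψ⟩
  · rintro ⟨C, hC⟩
    refine ⟨C, fun ⟨u, hu⟩ => ?_⟩
    have hu' := G.negLaplacianOn_domain_le _ hu
    exact (hC ⟨u, hu'⟩ ((G.mem_negLaplacianOn_domain ⟨u, hu'⟩).1 hu)).trans_eq
      (key C ⟨u, hu'⟩ hu).symm

/-- If `-Δ(M)` is quasi-accretive, then the multivalued part of `M` is orthogonal to its domain:
boundary data `χ + (0, η)` with arbitrarily large `η` are realised by functions `φ + ψ` with the
form of `ψ` arbitrarily small, which leaves `Re ⟨χ₁, η⟩` as the only contribution of `η`. -/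
theorem inner_eq_zero_of_isQuasiAccretive {M : Submodule ℂ (G.BdrySpace × G.BdrySpace)}
    (h : IsQuasiAccretive (G.negLaplacianOn M)) (χ : G.BdrySpace × G.BdrySpace) (hχ : χ ∈ M)
    (η : G.BdrySpace) (hη : (0, η) ∈ M) : inner ℂ χ.1 η = 0 := by
  obtain ⟨C, hform⟩ := G.isQuasiAccretive_negLaplacianOn_iff.1 h
  obtain ⟨φ, rfl⟩ := G.bdryMap_surjective χ
  set a : ℝ := -(inner ℂ (φ : G.Space) (G.maxOp φ)).re + C * ‖(φ : G.Space)‖ ^ 2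
  refine Complex.eq_zero_of_forall_nonneg_add_re_mul (a := a) fun z => ?_
  -- The multivalued part is a subspace, so it suffices to bound the form for `z • η` itself.
  rw [← inner_smul_right]
  have hzη : (0, z • η) ∈ M := by simpa using M.smul_mem z hη
  set r : ℝ := (inner ℂ (G.bdryMap φ).1 (z • η)).re
  -- For `‖ψ‖ ≤ δ ≤ 1`, the terms that involve `ψ`, other than `r`, add up to at most `δ * D`.
  set D : ℝ := 2 * ‖G.maxOp φ‖ + 2 * |C| * ‖(φ : G.Space)‖ + 1 + |C| with hD
  have hD0 : 0 < D := by positivity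
  refine le_of_forall_pos_le_add fun ε hε => ?_
  set δ : ℝ := min 1 (ε / D)
  have hδ : 0 < δ := by positivity
  have hδ1 : δ ≤ 1 := min_le_left _ _
  have hδD : δ * D ≤ ε := (le_div_iff₀ hD0).1 (min_le_right _ _)
  obtain ⟨ψ, hψ, hn, hq, hgreen⟩ := G.exists_small (z • η) (pow_pos hδ 2)
  have hn' : ‖(ψ : G.Space)‖ ≤ δ := (sq_le_sq₀ (norm_nonneg _) hδ.le).1 hn
  have hmem : G.bdryMap (φ + ψ) ∈ M := by rw [map_add, hψ]; exact M.add_mem hχ hzη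
  have h0 := hform (φ + ψ) hmem
  have hg := hgreen φ
  rw [map_add, Submodule.coe_add, inner_add_left, inner_add_right, inner_add_right, Complex.add_re,
    Complex.add_re, Complex.add_re, norm_add_sq (𝕜 := ℂ), RCLike.re_eq_complex_re] at h0
  change _ = -r at hg
  have hc1 : |(inner ℂ (ψ : G.Space) (G.maxOp φ)).re| ≤ δ * ‖G.maxOp φ‖ :=
    (Complex.abs_re_le_norm _).trans ((norm_inner_le_norm _ _).trans (by gcongr))
  have hc2 : |C * (inner ℂ (φ : G.Space) (ψ : G.Space)).re| ≤ |C| * (‖(φ : G.Space)‖ * δ) := by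
    rw [abs_mul]
    gcongr
    exact (Complex.abs_re_le_norm _).trans ((norm_inner_le_norm _ _).trans (by gcongr))
  have hc3 : C * ‖(ψ : G.Space)‖ ^ 2 ≤ |C| * δ ^ 2 := by
    calc C * ‖(ψ : G.Space)‖ ^ 2 ≤ |C| * ‖(ψ : G.Space)‖ ^ 2 := by gcongr; exact le_abs_self C
      _ ≤ |C| * δ ^ 2 := by gcongr
  have hδ2 : δ ^ 2 ≤ δ := by nlinarith
  have hδ3 : |C| * δ ^ 2 ≤ |C| * δ := by gcongr
  have e1 := (abs_le.1 hc1).1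
  have e2 := (abs_le.1 hc2).2
  have e3 := (abs_le.1 hq).1
  have e4 : δ * D = 2 * (δ * ‖G.maxOp φ‖) + 2 * (|C| * (‖(φ : G.Space)‖ * δ)) + δ + |C| * δ := by
    rw [hD]; ring
  simp only [a]
  linarith

theorem isQuasiAccretive_negLaplacianOn {M : Submodule ℂ (G.BdrySpace × G.BdrySpace)} {c : ℝ}
    (hc : 0 ≤ c) (h : ∀ χ ∈ M, -(c * ‖χ.1‖ ^ 2) ≤ (inner ℂ χ.1 χ.2).re) :
    IsQuasiAccretive (G.negLaplacianOn M) := by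
  obtain ⟨K, hK⟩ := G.exists_le_norm_sq_sub_inner hc
  refine G.isQuasiAccretive_negLaplacianOn_iff.2 ⟨K, fun ψ hψ => ?_⟩
  have h1 := hK ψ
  have h2 := h (G.bdryMap ψ) hψ
  rw [G.bdryMap_fst, G.bdryMap_snd] at h2
  linarith

/-- If `-Δ(M)` is quasi-m-accretive, then the multivalued part of `M` is the whole orthogonal
complement `Pᗮ` of its domain: adjoining `0 × Pᗮ` to `M` does not change `Re ⟨χ₁, χ₂⟩`, so by
maximality `M` already contains it. -/
theorem mem_iff_mem_orthogonal_of_isQuasiMAccretive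
    {M : Submodule ℂ (G.BdrySpace × G.BdrySpace)} (h : IsQuasiMAccretive (G.negLaplacianOn M))
    (η : G.BdrySpace) : (0, η) ∈ M ↔ η ∈ (M.map (LinearMap.fst ℂ G.BdrySpace G.BdrySpace))ᗮ := by
  set P := M.map (LinearMap.fst ℂ G.BdrySpace G.BdrySpace)
  have horth := G.inner_eq_zero_of_isQuasiAccretive h.quasiAccretive
  constructor
  · intro hη
    rw [Submodule.mem_orthogonal]
    rintro _ ⟨χ, hχ, rfl⟩
    exact horth χ hχ η hη
  · intro hη
    obtain ⟨c, hc, hMc⟩ := exists_neg_le_re_inner M horth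
    set N := M ⊔ Pᗮ.map (LinearMap.inr ℂ G.BdrySpace G.BdrySpace)
    have hN : IsQuasiAccretive (G.negLaplacianOn N) := by
      refine G.isQuasiAccretive_negLaplacianOn hc fun ξ hξ => ?_
      obtain ⟨χ, hχ, _, ⟨ζ, hζ, rfl⟩, rfl⟩ := Submodule.mem_sup.1 hξ
      have h0 : inner ℂ χ.1 ζ = 0 := (Submodule.mem_orthogonal _ _).1 hζ _ ⟨χ, hχ, rfl⟩
      have := hMc χ hχ
      simpa [inner_add_right, h0] using this
    have heq : N = M := G.negLaplacianOn_injective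
      (h.maximal _ (G.negLaplacianOn_mono le_sup_left) hN)
    rw [← heq]
    exact Submodule.mem_sup_right ⟨η, hη, rfl⟩

end MetricGraph

theorem proposition1 {V I E : Type*} [Fintype V] [Fintype I] [Fintype E]
    (G : MetricGraph V I E) (T : G.Space →ₗ.[ℂ] G.Space)
    (hmin : -G.minLaplacian ≤ T) (hmax : T ≤ -G.laplacian) (hT : IsQuasiMAccretive T) :
    ∃ A B : G.BdrySpace →ₗ[ℂ] G.BdrySpace,
      Function.Surjective (A.coprod B) ∧
      Module.finrank ℂ (LinearMap.range (A.coprod B)) = Fintype.card E + 2 * Fintype.card I ∧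
      T = G.negLaplacianAB A B := by
  have hTM := G.eq_negLaplacianOn hmin hmax
  set M := (T.domain.comap G.maxDomain.subtype).map G.bdryMap
  have hrank := finrank_eq_of_multivalued_eq_orthogonal M
    (G.mem_iff_mem_orthogonal_of_isQuasiMAccretive (hTM ▸ hT))
  obtain ⟨A, B, hsurj, hker⟩ := exists_coprod_ker_eq M hrank
  refine ⟨A, B, hsurj, ?_, ?_⟩
  · rw [LinearMap.range_eq_top.2 hsurj, finrank_top, finrank_euclideanSpace, Fintype.card_sum,
      Fintype.card_sum]
    ring
  · rw [MetricGraph.negLaplacianAB, MetricGraph.bdryKer, hker]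
    exact hTM
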